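/- **Model.** Macro base stations form a homogeneous Poisson point process $\Phi_1$ of density $\lambda_1>0$ in $\mathbb R^2$; the typical user is at the origin. A file $f$ is cached at each station independently with probability $p_{1,f}\in[0,1]$; $\Phi_{1,f}$ denotes the set of stations that cache it and $\Phi_{1,f'}=\Phi_1\setminus\Phi_{1,f}$ the set of those that do not. The station at $x$ has a small-scale fading coefficient $h_x$; the fading is Rayleigh, i.e. the $|h_x|^2$ are exponential with mean $1$, independent across stations, and independent of the locations and of the caching (which is itself independent of the locations). With transmit power $P_1>0$, path loss law $L_1(r)=C_1r^{-\alpha_1}$ ($C_1>0$), $N_1\ge 1$ antenna elements, omnidirectional array gain $G_1\equiv 1$, maximum directivity gain $G_0=1$ and noise power $\sigma_1^2>0$, the user is served by the point $x_0$ of $\Phi_{1,f}$ nearest to it, and its SINR is $$\Upsilon_{1,f}=\frac{P_1L_1(\|x_0\|)G_0N_1|h_{x_0}|^2}{\sigma_1^2+\sum_{x\in\Phi_{1,f}\setminus\{x_0\}}P_1L_1(\|x\|)N_1|h_x|^2+\sum_{x\in\Phi_{1,f'}}P_1L_1(\|x\|)N_1|h_x|^2}$$ ($\Upsilon_{1,f}=0$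 if $\Phi_{1,f}$ is empty). **Statement.** If $\alpha_1=4$, then for every threshold $\tau>0$ the coverage probability of the macro tier is $$\mathbb P[\Upsilon_{1,f}>\tau]=\frac12\,\pi p_{1,f}\lambda_1\sqrt{\frac{\pi}{B(\tau)}}\,\exp\!\Big(\frac{C(\tau)^2}{4B(\tau)}\Big)\operatorname{erfc}\!\Big(\frac{C(\tau)}{2\sqrt{B(\tau)}}\Big),$$ where $\operatorname{erfc}(x)=\frac{2}{\sqrt\pi}\int_x^\infty e^{-t^2}\,dt$, $$B(\tau)=\frac{\tau\sigma_1^2}{P_1C_1N_1G_0},\qquad C(\tau)=\pi\lambda_1\big(p_{1,f}S_1^0(\tau)+(1-p_{1,f})\Delta_1(\tau)\big),$$ $$S_1^0(\tau)={}_2F_1\Big(-\tfrac{2}{\alpha_1},1;1-\tfrac{2}{\alpha_1};-\tau\Big),\qquad \Delta_1(\tau)=\Gamma\Big(1-\tfrac2{\alpha_1}\Big)\Gamma\Big(1+\tfrac2{\alpha_1}\Big)\tau^{2/\alpha_1},$$ and ${}_2F_1$ is the Gauss hypergeometric function (analytically continued along the negative real axis for $\tau\ge1$). -/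

import Mathlib

open MeasureTheory ProbabilityTheory
open scoped ENNReal

namespace CacheHetNet

noncomputable section

/-! ### Special functions -/

/-- The complementary error function `erfc x = (2 / √π) ∫_x^∞ exp (-t²) dt`. -/
def erfc (x : ℝ) : ℝ := 2 / √Real.pi * ∫ t in Set.Ioi x, Real.exp (-t ^ 2)

/-- `F` is the (real-)analytic continuation to `(-∞, 1)` of the sum of the Gauss hypergeometric
series with parameters `a, b; c`, which itself converges only on `(-1, 1)`. -/
def IsGaussContinuation (a b c : ℝ) (F : ℝ → ℝ) : Prop :=
  AnalyticOnNhd ℝ F (Set.Iio 1) ∧ ∀ y : ℝ, |y| < 1 → F y = ordinaryHypergeometric a b c y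

open Classical in
/-- The Gauss hypergeometric function `₂F₁(a, b; c; x)` for real `x < 1`: the value at `x` of the
analytic continuation of the hypergeometric series. -/
def gauss2F1 (a b c x : ℝ) : ℝ :=
  if h : ∃ F : ℝ → ℝ, IsGaussContinuation a b c F then h.choose x else 0

/-- The continuation is unique, so that `gauss2F1` does not depend on any choice. -/
theorem gauss2F1_eq {a b c : ℝ} {F : ℝ → ℝ} (hF : IsGaussContinuation a b c F) {x : ℝ}
    (hx : x < 1) : gauss2F1 a b c x = F x := by
  have h : ∃ F : ℝ → ℝ, IsGaussContinuation a b c F := ⟨F, hF⟩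
  have hG := h.choose_spec
  rw [gauss2F1, dif_pos h]
  refine hG.1.eqOn_of_preconnected_of_eventuallyEq hF.1 isPreconnected_Iio
    (z₀ := 0) (by simp) ?_ hx
  filter_upwards [Metric.ball_mem_nhds (0 : ℝ) one_pos] with y hy
  have hy' : |y| < 1 := by simpa using hy
  rw [hG.2 y hy', hF.2 y hy']

/-- `S^k(z) = ₂F₁(k - 2/α, k + N; k + 1 - 2/α; -z)` for path loss exponent `α` and integer
fading parameter `N`. -/
def S (k : ℕ) (α : ℝ) (N : ℕ) (z : ℝ) : ℝ :=
  gauss2F1 (k - 2 / α) (k + N) (k + 1 - 2 / α) (-z)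

/-- `Δ(z) = Γ(1 - 2/α) Γ(N + 2/α) Γ(N)⁻¹ z^(2/α)`. -/
def Δ (α : ℝ) (N : ℕ) (z : ℝ) : ℝ :=
  Real.Gamma (1 - 2 / α) * Real.Gamma (N + 2 / α) * (Real.Gamma N)⁻¹ * z ^ (2 / α)

/-! ### The macro tier -/

/-- The plane, with its Euclidean norm and Lebesgue measure. -/
abbrev Plane : Type := EuclideanSpace ℝ (Fin 2)

section Model

variable {Ω : Type*} [MeasurableSpace Ω]

/-- The number of points of the random configuration `{X n ω : n ∈ ℕ}` that lie in `A`. -/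
def pointCount (X : ℕ → Ω → Plane) (A : Set Plane) (ω : Ω) : ℝ≥0∞ :=
  ∑' n, A.indicator (fun _ => (1 : ℝ≥0∞)) (X n ω)

/-- `X 0, X 1, …` is an enumeration of the points of a homogeneous Poisson point process of
density `lam` in the plane: the number of points in a Borel set of finite area is Poisson
distributed with mean `lam` times the area, and the numbers of points in finitely many pairwise
disjoint Borel sets are independent. -/
structure IsHPPP (μ : Measure Ω) (lam : ℝ) (X : ℕ → Ω → Plane) : Prop where
  measurable : ∀ n, Measurable (X n)
  poisson : ∀ A : Set Plane, MeasurableSet A → volume A ≠ ∞ →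
    HasLaw (pointCount X A)
      ((poissonMeasure (lam * volume.real A).toNNReal).map (fun k : ℕ => (k : ℝ≥0∞))) μ
  indep : ∀ (k : ℕ) (A : Fin k → Set Plane), (∀ i, MeasurableSet (A i)) →
    Pairwise (fun i j => Disjoint (A i) (A j)) → iIndepFun (fun i => pointCount X (A i)) μ

/-- The macro tier, seen from the typical user at the origin. The macro base stations form a
homogeneous Poisson point process `{X n}` of density `lam`. Independently of the locations, of the
fading and of each other, they cache the requested file with probability `p` (`cached n`). The
small-scale fading coefficients `h n` are independent, independent of everything else, and Rayleigh:
the fading power `‖h n‖²` is exponential with mean one. -/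
structure IsMacroTier (μ : Measure Ω) (lam p : ℝ) (X : ℕ → Ω → Plane) (h : ℕ → Ω → ℂ)
    (cached : ℕ → Ω → Bool) : Prop where
  hppp : IsHPPP μ lam X
  measurable_fading : ∀ n, Measurable (h n)
  measurable_cached : ∀ n, Measurable (cached n)
  rayleigh : ∀ n, HasLaw (fun ω => ‖h n ω‖ ^ 2) (expMeasure 1) μ
  prob_cached : ∀ n, μ {ω | cached n ω = true} = ENNReal.ofReal p
  indep_fading : iIndepFun h μ
  indep_cached : iIndepFun cached μ
  indep_fading_cached : IndepFun (fun ω n => h n ω) (fun ω n => cached n ω) μ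
  indep_location_marks : IndepFun (fun ω n => X n ω) (fun ω n => (h n ω, cached n ω)) μ

/-- The path loss law `L₁(r) = C r^(-α)`. -/
def pathLoss (C α r : ℝ) : ℝ := C * r ^ (-α)

/-- The maximum directivity gain `G₀`, normalised to one. -/
def G₀ : ℝ := 1

/-- The array gain function of a macro base station, which is omnidirectional. -/
def arrayGain (_angle : ℝ) : ℝ := 1

/-- Station `n` is a nearest one to the user at the origin among those caching the file. -/
def IsNearestCaching (X : ℕ → Ω → Plane) (cached : ℕ → Ω → Bool) (ω : Ω) (n : ℕ) : Prop :=
  cached n ω = true ∧ ∀ m, cached m ω = true → ‖X n ω‖ ≤ ‖X m ω‖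

/-- The power `P L₁(‖x‖) H^x`, `H^x = N |h|² G₁(·)`, that the user receives from an interfering
station `n`. The angle is irrelevant, since macro base stations are omnidirectional. -/
def interferingPower (P C α : ℝ) (N : ℕ) (X : ℕ → Ω → Plane) (h : ℕ → Ω → ℂ) (n : ℕ) (ω : Ω) :
    ℝ≥0∞ :=
  ENNReal.ofReal (P * pathLoss C α ‖X n ω‖ * (N * ‖h n ω‖ ^ 2 * arrayGain 0))

open Classical in
/-- Interference from the stations other than the serving one `n₀` that cache the file. -/
def interferenceCaching (P C α : ℝ) (N : ℕ) (X : ℕ → Ω → Plane) (h : ℕ → Ω → ℂ)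
    (cached : ℕ → Ω → Bool) (n₀ : ℕ) (ω : Ω) : ℝ≥0∞ :=
  ∑' n, if cached n ω = true ∧ n ≠ n₀ then interferingPower P C α N X h n ω else 0

/-- Interference from the stations that do not cache the file. -/
def interferenceNonCaching (P C α : ℝ) (N : ℕ) (X : ℕ → Ω → Plane) (h : ℕ → Ω → ℂ)
    (cached : ℕ → Ω → Bool) (ω : Ω) : ℝ≥0∞ :=
  ∑' n, if cached n ω = false then interferingPower P C α N X h n ω else 0

/-- The SINR of the user when it is served by station `n₀`; the noise power is `σ²`. -/
def sinrFrom (P C α σ : ℝ) (N : ℕ) (X : ℕ → Ω → Plane) (h : ℕ → Ω → ℂ)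
    (cached : ℕ → Ω → Bool) (n₀ : ℕ) (ω : Ω) : ℝ≥0∞ :=
  ENNReal.ofReal (P * pathLoss C α ‖X n₀ ω‖ * G₀ * N * ‖h n₀ ω‖ ^ 2) /
    (ENNReal.ofReal (σ ^ 2) + interferenceCaching P C α N X h cached n₀ ω +
      interferenceNonCaching P C α N X h cached ω)

open Classical in
/-- The SINR `Υ_{1,f}` of the user, who is served by the nearest macro base station that caches the
file (the one of least index, in the null event of a tie); it is `0` if there is no such station. -/
def sinr (P C α σ : ℝ) (N : ℕ) (X : ℕ → Ω → Plane) (h : ℕ → Ω → ℂ)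
    (cached : ℕ → Ω → Bool) (ω : Ω) : ℝ≥0∞ :=
  if hn : ∃ n, IsNearestCaching X cached ω n then
    sinrFrom P C α σ N X h cached (Nat.find hn) ω
  else 0

/-- The coverage probability `ℙ[Υ_{1,f} > τ]`. -/
def coverageProbability (μ : Measure Ω) (P C α σ : ℝ) (N : ℕ) (X : ℕ → Ω → Plane)
    (h : ℕ → Ω → ℂ) (cached : ℕ → Ω → Bool) (τ : ℝ) : ℝ :=
  μ.real {ω | ENNReal.ofReal τ < sinr P C α σ N X h cached ω}

end Model

/-! ### The two quantities in the closed form -/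

/-- `B(τ) = τ σ² / (P C N G₀)`. -/
def coeffB (P C σ : ℝ) (N : ℕ) (τ : ℝ) : ℝ := τ * σ ^ 2 / (P * C * N * G₀)

/-- `C(τ) = π lam (p S⁰(τ) + (1 - p) Δ(τ))`, for the Rayleigh fading parameter `1`. -/
def coeffC (lam p α τ : ℝ) : ℝ :=
  Real.pi * lam * (p * S 0 α 1 τ + (1 - p) * Δ α 1 τ)

end

end CacheHetNet

namespace CacheHetNet

noncomputable section

open Filter Set
open scoped Topology NNReal

/-! ### The function `exp (-t)` on the extended nonnegative reals -/

/-! Fix the locations, and let station `n` lie at distance `r`. The event that `n` serves and covers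
the user splits into a caching event and a fading event, which are independent. The caching event
has probability `p` times a factor `1 - p` for each station nearer than `r`. The fading event asks
an exponential variable to exceed `B r⁴` plus a scaled interference sum; as the exponential tail is
`exp (-t)`, its probability is `exp (-B r⁴)` times a Laplace transform, with a factor `1 / (1 + τ r⁴
/ ‖X m‖⁴)` for each other station. Everything is thus the exponential of a sum over the points, with
summand `radialWeight` (`IsMacroTier.measure_servedSet`).

Almost surely no two stations are equidistant (`IsHPPP.ae_norm_ne`), so these events are disjoint
and their probabilities add up. The Mecke formula (`IsHPPP.mecke_radial_univ`) evaluates the sum as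
`p lam ∫ exp (-B ‖x‖⁴ - lam ∫ (1 - exp (-radialWeight)))`. In polar coordinates the inner integral
is elementary: at exponent four it is an arctangent, and `lam` times it equals `C r²`
(`integral_mul_radialLoss`, `S_zero_four_one`, `Δ_four_one`). What remains is `2π ∫ r exp (-B r⁴ - C
r²) dr`, a Gaussian tail in the variable `r²` (`integral_mul_exp_quartic`).

The Mecke formula is derived from the counting definition of the process. Independence of counts
gives the Laplace functional on simple functions, and limits give it in general (`IsHPPP.laplace`).
Differentiating it in the direction of an indicator yields `IsHPPP.lintegral_pointCount_mul_expNeg`,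
and discretising the radius from below lets the functional depend on the distinguished point.
Working with `expNeg` on `[0, ∞]` removes all convergence questions, and covers `p = 1`, where the
weight of a nearer station is `∞`. -/

/-- The function `exp (-t)` on `[0, ∞]`, with value `0` at `∞`. -/
def expNeg (t : ℝ≥0∞) : ℝ≥0∞ := EReal.exp (-(t : EReal))

@[simp] lemma expNeg_zero : expNeg 0 = 1 := by simp [expNeg]

@[simp] lemma expNeg_top : expNeg ∞ = 0 := by simp [expNeg]

lemma expNeg_eq_inv (t : ℝ≥0∞) : expNeg t = (EReal.exp t)⁻¹ := EReal.exp_neg _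

lemma expNeg_ofReal {t : ℝ} (ht : 0 ≤ t) :
    expNeg (ENNReal.ofReal t) = ENNReal.ofReal (Real.exp (-t)) := by
  rw [expNeg, EReal.coe_ennreal_ofReal, max_eq_left ht, ← EReal.coe_neg, EReal.exp_coe]

lemma expNeg_add (s t : ℝ≥0∞) : expNeg (s + t) = expNeg s * expNeg t := by
  rw [expNeg_eq_inv, expNeg_eq_inv, expNeg_eq_inv, EReal.coe_ennreal_add, EReal.exp_add,
    ENNReal.mul_inv]
  · left; simp
  · right; simp

lemma expNeg_antitone : Antitone expNeg := fun s t h => by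
  rw [expNeg, expNeg, EReal.exp_le_exp_iff, EReal.neg_le_neg_iff]
  exact_mod_cast h

lemma expNeg_le_one (t : ℝ≥0∞) : expNeg t ≤ 1 := by
  simpa using expNeg_antitone (zero_le : 0 ≤ t)

lemma expNeg_ne_top (t : ℝ≥0∞) : expNeg t ≠ ∞ := ne_top_of_le_ne_top (by simp) (expNeg_le_one t)

lemma continuous_expNeg : Continuous expNeg :=
  ENNReal.continuous_exp.comp (continuous_neg.comp continuous_coe_ennreal_ereal)

@[fun_prop]
lemma measurable_expNeg : Measurable expNeg := continuous_expNeg.measurable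

lemma expNeg_sum {ι : Type*} (s : Finset ι) (f : ι → ℝ≥0∞) :
    expNeg (∑ i ∈ s, f i) = ∏ i ∈ s, expNeg (f i) := by
  classical
  induction s using Finset.induction_on with
  | empty => simp
  | insert i s hi ih => rw [Finset.sum_insert hi, Finset.prod_insert hi, expNeg_add, ih]

lemma expNeg_mul_natCast (a : ℝ≥0∞) (k : ℕ) : expNeg (a * k) = expNeg a ^ k := by
  simpa [mul_comm] using expNeg_sum (Finset.range k) (fun _ => a)

/-- The function `-log v` on `[0, 1]`, the inverse of `expNeg`. -/
def negLog (v : ℝ≥0∞) : ℝ≥0∞ := (-(ENNReal.log v)).toENNReal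

lemma expNeg_negLog {v : ℝ≥0∞} (hv : v ≤ 1) : expNeg (negLog v) = v := by
  have h : (0 : EReal) ≤ -ENNReal.log v := by
    rw [EReal.neg_nonneg, ← ENNReal.log_one]
    exact ENNReal.log_monotone hv
  rw [expNeg, negLog, EReal.coe_toENNReal h, neg_neg, ENNReal.exp_log]

lemma negLog_antitone : Antitone negLog := fun _ _ h =>
  EReal.toENNReal_le_toENNReal (EReal.neg_le_neg_iff.2 (ENNReal.log_monotone h))

@[fun_prop]
lemma measurable_negLog : Measurable negLog := negLog_antitone.measurable

lemma expNeg_injective : Function.Injective expNeg := fun s t h => by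
  have := EReal.exp_strictMono.injective h
  simpa using this

lemma negLog_expNeg (t : ℝ≥0∞) : negLog (expNeg t) = t :=
  expNeg_injective (expNeg_negLog (expNeg_le_one t))

/-- Infinite products of numbers in `[0, 1]`. -/
lemma tendsto_prod_expNeg (f : ℕ → ℝ≥0∞) :
    Tendsto (fun M => ∏ i ∈ Finset.range M, expNeg (f i)) atTop (𝓝 (expNeg (∑' i, f i))) := by
  simp_rw [← expNeg_sum]
  exact (continuous_expNeg.tendsto _).comp ENNReal.summable.hasSum.tendsto_sum_nat

/-! ### Poisson and exponential distributions -/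

lemma lintegral_poissonMeasure (r : ℝ≥0) (g : ℕ → ℝ≥0∞) :
    ∫⁻ k, g k ∂(poissonMeasure r) =
      ∑' k : ℕ, ENNReal.ofReal (Real.exp (-r) * r ^ k / k.factorial) * g k := by
  rw [poissonMeasure, lintegral_sum_measure]
  simp

/-- The probability generating function of the Poisson law, by the exponential series. The value `a
= ∞` is included and gives the probability of a zero count. -/
lemma lintegral_expNeg_poissonMeasure (r : ℝ≥0) (a : ℝ≥0∞) :
    ∫⁻ k : ℕ, expNeg (a * k) ∂(poissonMeasure r) = expNeg (r * (1 - expNeg a)) := by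
  rw [lintegral_poissonMeasure]
  obtain ⟨q, hq⟩ : ∃ q : ℝ≥0, expNeg a = q := ⟨_, (ENNReal.coe_toNNReal (expNeg_ne_top a)).symm⟩
  have hq1 : (q : ℝ) ≤ 1 := by
    have := expNeg_le_one a
    rw [hq] at this
    exact_mod_cast this
  have h1 : (r : ℝ≥0∞) * (1 - expNeg a) = ENNReal.ofReal (r * (1 - q)) := by
    rw [ENNReal.ofReal_mul r.coe_nonneg, ENNReal.ofReal_sub _ q.coe_nonneg, hq]
    simp
  rw [h1, expNeg_ofReal (mul_nonneg r.coe_nonneg (by linarith))]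
  have hs : HasSum (fun k : ℕ => Real.exp (-r) * ((r * q : ℝ) ^ k / k.factorial))
      (Real.exp (-(r * (1 - q)))) := by
    have h2 := (NormedSpace.expSeries_div_hasSum_exp (r * q : ℝ)).mul_left (Real.exp (-r))
    rw [← Real.exp_eq_exp_ℝ, ← Real.exp_add] at h2
    convert! h2 using 2
    ring
  rw [← hs.tsum_eq, ENNReal.ofReal_tsum_of_nonneg (fun k => by positivity) hs.summable]
  refine tsum_congr fun k => ?_
  rw [expNeg_mul_natCast, hq, ← ENNReal.ofReal_coe_nnreal, ← ENNReal.ofReal_pow q.coe_nonneg,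
    ← ENNReal.ofReal_mul (by positivity)]
  congr 1
  rw [mul_pow]
  ring

lemma lintegral_natCast_poissonMeasure (r : ℝ≥0) :
    ∫⁻ k : ℕ, (k : ℝ≥0∞) ∂(poissonMeasure r) = r := by
  rw [lintegral_poissonMeasure]
  have hs : HasSum (fun k : ℕ => Real.exp (-r) * r ^ k / k.factorial * (k : ℝ)) r := by
    -- The term at `k = 0` vanishes; the shifted series is `r` times the exponential series.
    rw [← hasSum_nat_add_iff' 1]
    have h2 := (NormedSpace.expSeries_div_hasSum_exp (r : ℝ)).mul_left (Real.exp (-r) * r)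
    rw [← Real.exp_eq_exp_ℝ, mul_right_comm, ← Real.exp_add] at h2
    convert! h2 using 1
    · ext k
      rw [Nat.factorial_succ]
      push_cast
      field_simp
      ring
    · simp
  calc _ = ∑' k : ℕ, ENNReal.ofReal (Real.exp (-r) * r ^ k / k.factorial * (k : ℝ)) := by
        refine tsum_congr fun k => ?_
        rw [ENNReal.ofReal_mul (by positivity), ENNReal.ofReal_natCast]
    _ = ENNReal.ofReal (∑' k : ℕ, Real.exp (-r) * r ^ k / k.factorial * (k : ℝ)) :=
        (ENNReal.ofReal_tsum_of_nonneg (fun k => by positivity) hs.summable).symm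
    _ = r := by rw [hs.tsum_eq, ENNReal.ofReal_coe_nnreal]

lemma expMeasure_Ioi {t : ℝ} (ht : 0 ≤ t) :
    expMeasure 1 (Ioi t) = ENNReal.ofReal (Real.exp (-t)) := by
  have := isProbabilityMeasure_expMeasure one_pos
  rw [← compl_Iic, prob_compl_eq_one_sub measurableSet_Iic, ← ofReal_cdf,
    cdf_expMeasure_eq one_pos, if_pos ht, ← ENNReal.ofReal_one, ← ENNReal.ofReal_sub]
  · simp
  · simpa using ht

/-- This is where Rayleigh fading enters: the tail of the fading power is itself an exponential, so
coverage probabilities become Laplace transforms. -/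
lemma expMeasure_lt_ofReal (z : ℝ≥0∞) :
    expMeasure 1 {y | z < ENNReal.ofReal y} = expNeg z := by
  induction z with
  | top => simp
  | coe z =>
    have : {y : ℝ | (z : ℝ≥0∞) < ENNReal.ofReal y} = Ioi (z : ℝ) := by
      ext y
      simp only [mem_ofPred_eq, mem_Ioi, ← ENNReal.ofReal_coe_nnreal (p := z)]
      exact ENNReal.ofReal_lt_ofReal_iff_of_nonneg z.coe_nonneg
    rw [this, expMeasure_Ioi z.coe_nonneg, ← ENNReal.ofReal_coe_nnreal (p := z),
      expNeg_ofReal z.coe_nonneg]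

/-- Tilting the unit exponential density by `exp (-b y)` gives `1 / (1 + b)` times the density of
rate `1 + b`. -/
lemma lintegral_expNeg_expMeasure {b : ℝ} (hb : 0 ≤ b) :
    ∫⁻ y, expNeg (ENNReal.ofReal (b * y)) ∂(expMeasure 1) = ENNReal.ofReal (1 / (1 + b)) := by
  have hb1 : 0 < 1 + b := by linarith
  rw [expMeasure, gammaMeasure, lintegral_withDensity_eq_lintegral_mul _
    (show Measurable (gammaPDF 1 1) from (measurable_gammaPDFReal 1 1).ennreal_ofReal)
    (by fun_prop)]
  have h1 : ∀ y : ℝ, (gammaPDF 1 1 * fun y => expNeg (ENNReal.ofReal (b * y))) y =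
      ENNReal.ofReal (1 / (1 + b)) * exponentialPDF (1 + b) y := by
    intro y
    rw [Pi.mul_apply, show gammaPDF 1 1 y = exponentialPDF 1 y from rfl]
    rcases lt_or_ge y 0 with hy | hy
    · rw [exponentialPDF_of_neg hy, exponentialPDF_of_neg hy]; simp
    · rw [exponentialPDF_of_nonneg hy, exponentialPDF_of_nonneg hy,
        expNeg_ofReal (mul_nonneg hb hy), ← ENNReal.ofReal_mul (by positivity),
        ← ENNReal.ofReal_mul (by positivity), one_mul, ← Real.exp_add]
      congr 1
      rw [← mul_assoc, one_div_mul_cancel hb1.ne', one_mul]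
      ring_nf
  simp_rw [h1]
  rw [lintegral_const_mul _ (show Measurable (exponentialPDF (1 + b)) from
    (measurable_exponentialPDFReal _).ennreal_ofReal), lintegral_exponentialPDF_eq_one hb1, mul_one]

/-! ### The Laplace functional of a Poisson point process -/

/-- Monotone convergence for the counting measure. -/
lemma tendsto_tsum_of_monotone {g : ℕ → ℕ → ℝ≥0∞} {G : ℕ → ℝ≥0∞} (hg : ∀ n, Monotone fun k => g k n)
    (hG : ∀ n, Tendsto (fun k => g k n) atTop (𝓝 (G n))) :
    Tendsto (fun k => ∑' n, g k n) atTop (𝓝 (∑' n, G n)) := by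
  simp_rw [← lintegral_count]
  exact lintegral_tendsto_of_tendsto_of_monotone (fun k => Measurable.of_discrete.aemeasurable)
    (ae_of_all _ hg) (ae_of_all _ hG)

lemma tsum_indicator_const_mul {Ω : Type*} (X : ℕ → Ω → Plane) (A : Set Plane) (a : ℝ≥0∞) (ω : Ω) :
    ∑' n, A.indicator (fun _ => a) (X n ω) = a * pointCount X A ω := by
  rw [pointCount, ← ENNReal.tsum_mul_left]
  refine tsum_congr fun n => ?_
  by_cases h : X n ω ∈ A <;> simp [h]

lemma tsum_simpleFunc {Ω : Type*} (X : ℕ → Ω → Plane) (s : SimpleFunc Plane ℝ≥0∞) (ω : Ω) :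
    ∑' n, s (X n ω) = ∑ y ∈ s.range, y * pointCount X (s ⁻¹' {y}) ω := by
  simp_rw [← tsum_indicator_const_mul]
  rw [← Summable.tsum_finsetSum fun _ _ => ENNReal.summable]
  refine tsum_congr fun n => ?_
  rw [Finset.sum_eq_single_of_mem (s (X n ω)) (s.mem_range_self _)]
  · simp
  · intro y _ hy
    rw [indicator_of_notMem]
    simpa using hy.symm

section Poisson

variable {Ω : Type*} [MeasurableSpace Ω] {μ : Measure Ω} {lam : ℝ} {X : ℕ → Ω → Plane}

lemma IsHPPP.measurable_pointCount (hX : IsHPPP μ lam X) {A : Set Plane} (hA : MeasurableSet A) :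
    Measurable (pointCount X A) :=
  Measurable.tsum fun n => (measurable_const.indicator hA).comp (hX.measurable n)

lemma IsHPPP.measurable_tsum (hX : IsHPPP μ lam X) {f : Plane → ℝ≥0∞} (hf : Measurable f) :
    Measurable fun ω => ∑' n, f (X n ω) :=
  Measurable.tsum fun n => hf.comp (hX.measurable n)

lemma IsHPPP.lintegral_comp_pointCount (hX : IsHPPP μ lam X) {A : Set Plane} (hA : MeasurableSet A)
    (hA' : volume A ≠ ∞) {g : ℝ≥0∞ → ℝ≥0∞} (hg : Measurable g) :
    ∫⁻ ω, g (pointCount X A ω) ∂μ =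
      ∫⁻ k : ℕ, g k ∂(poissonMeasure (lam * volume.real A).toNNReal) := by
  rw [(hX.poisson A hA hA').lintegral_comp hg.aemeasurable,
    lintegral_map hg (measurable_from_nat)]

lemma coe_toNNReal_mul_volume (hlam : 0 ≤ lam) {A : Set Plane} (hA' : volume A ≠ ∞) :
    (((lam * volume.real A).toNNReal : ℝ≥0) : ℝ≥0∞) = ENNReal.ofReal lam * volume A := by
  change ENNReal.ofReal _ = _
  rw [ENNReal.ofReal_mul hlam, measureReal_def, ENNReal.ofReal_toReal hA']

lemma IsHPPP.lintegral_pointCount (hX : IsHPPP μ lam X) (hlam : 0 ≤ lam) {A : Set Plane}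
    (hA : MeasurableSet A) (hA' : volume A ≠ ∞) :
    ∫⁻ ω, pointCount X A ω ∂μ = ENNReal.ofReal lam * volume A := by
  have h := hX.lintegral_comp_pointCount hA hA' (g := id) measurable_id
  simp only [id] at h
  rw [h, lintegral_natCast_poissonMeasure, coe_toNNReal_mul_volume hlam hA']

lemma IsHPPP.lintegral_expNeg_mul_pointCount (hX : IsHPPP μ lam X) (hlam : 0 ≤ lam) {A : Set Plane}
    (hA : MeasurableSet A) (hA' : volume A ≠ ∞) (a : ℝ≥0∞) :
    ∫⁻ ω, expNeg (a * pointCount X A ω) ∂μ =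
      expNeg (ENNReal.ofReal lam * ((1 - expNeg a) * volume A)) := by
  rw [hX.lintegral_comp_pointCount hA hA' (g := fun t => expNeg (a * t)) (by fun_prop),
    lintegral_expNeg_poissonMeasure, coe_toNNReal_mul_volume hlam hA']
  ring_nf

/-- The level sets of `s` are disjoint, so their counts are independent and the expectation factors
into Poisson generating functions. The level set of the value `0` may have infinite area, but its
factor is `1`. -/
lemma IsHPPP.laplace_simpleFunc [IsProbabilityMeasure μ] (hX : IsHPPP μ lam X) (hlam : 0 ≤ lam)
    (s : SimpleFunc Plane ℝ≥0∞) (hs : ∀ y ≠ 0, volume (s ⁻¹' {y}) ≠ ∞) :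
    ∫⁻ ω, expNeg (∑' n, s (X n ω)) ∂μ =
      expNeg (ENNReal.ofReal lam * ∫⁻ x, (1 - expNeg (s x))) := by
  set e := s.range.equivFin with he
  have hindep := hX.indep _ (fun i => s ⁻¹' {(e.symm i : ℝ≥0∞)})
    (fun i => s.measurableSet_preimage _) (by
      intro i j hij
      refine Disjoint.preimage _ (disjoint_singleton.2 fun h => hij ?_)
      exact e.symm.injective (Subtype.ext h))
  have hindep' := hindep.comp (fun i t => expNeg ((e.symm i : ℝ≥0∞) * t)) (fun i => by fun_prop)
  have hsum : ∀ g : ℝ≥0∞ → ℝ≥0∞, ∑ y ∈ s.range, g y = ∑ i, g (e.symm i : ℝ≥0∞) := by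
    intro g
    rw [← Finset.sum_coe_sort, ← Equiv.sum_comp e.symm]
  calc ∫⁻ ω, expNeg (∑' n, s (X n ω)) ∂μ
      = ∫⁻ ω, ∏ i, expNeg ((e.symm i : ℝ≥0∞) *
          pointCount X (s ⁻¹' {(e.symm i : ℝ≥0∞)}) ω) ∂μ := by
        refine lintegral_congr fun ω => ?_
        rw [tsum_simpleFunc, hsum (fun y => y * pointCount X (s ⁻¹' {y}) ω), expNeg_sum]
    _ = ∏ i, ∫⁻ ω, expNeg ((e.symm i : ℝ≥0∞) *
          pointCount X (s ⁻¹' {(e.symm i : ℝ≥0∞)}) ω) ∂μ :=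
        lintegral_prod_eq_prod_lintegral_of_indepFun _ _ hindep' fun i =>
          measurable_expNeg.comp ((hX.measurable_pointCount
            (s.measurableSet_preimage _)).const_mul _)
    _ = ∏ i, expNeg (ENNReal.ofReal lam * ((1 - expNeg (e.symm i : ℝ≥0∞)) *
          volume (s ⁻¹' {(e.symm i : ℝ≥0∞)}))) := by
        refine Finset.prod_congr rfl fun i _ => ?_
        by_cases h0 : (e.symm i : ℝ≥0∞) = 0
        · simp [h0]
        · exact hX.lintegral_expNeg_mul_pointCount hlam (s.measurableSet_preimage _) (hs _ h0) _
    _ = _ := by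
        have h1 : ∫⁻ x, (1 - expNeg (s x)) = (s.map fun y => 1 - expNeg y).lintegral volume := by
          rw [← SimpleFunc.lintegral_eq_lintegral]
          rfl
        rw [← expNeg_sum, ← Finset.mul_sum, h1, SimpleFunc.map_lintegral,
          hsum fun y => (1 - expNeg y) * volume (s ⁻¹' {y})]

/-- The Laplace functional of a homogeneous Poisson point process. -/
theorem IsHPPP.laplace [IsProbabilityMeasure μ] (hX : IsHPPP μ lam X) (hlam : 0 ≤ lam)
    {f : Plane → ℝ≥0∞} (hf : Measurable f) :
    ∫⁻ ω, expNeg (∑' n, f (X n ω)) ∂μ =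
      expNeg (ENNReal.ofReal lam * ∫⁻ x, (1 - expNeg (f x))) := by
  -- Truncation to balls gives the nonzero level sets finite area while keeping the approximation
  -- increasing.
  set s : ℕ → SimpleFunc Plane ℝ≥0∞ := fun k =>
    (SimpleFunc.eapprox f k).restrict (Metric.ball 0 k) with hs
  have hsapp : ∀ k x, s k x = (Metric.ball (0 : Plane) k).indicator (SimpleFunc.eapprox f k) x :=
    fun k x => by rw [hs, SimpleFunc.restrict_apply _ Metric.isOpen_ball.measurableSet]
  have hmono : ∀ x, Monotone fun k => s k x := by
    intro x k l hkl
    simp only [hsapp]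
    refine (indicator_le_indicator (SimpleFunc.monotone_eapprox f hkl x)).trans ?_
    exact indicator_le_indicator_of_subset (Metric.ball_subset_ball (by exact_mod_cast hkl))
      (fun _ => zero_le) x
  have hlim : ∀ x, Tendsto (fun k => s k x) atTop (𝓝 (f x)) := by
    intro x
    refine (SimpleFunc.tendsto_eapprox hf x).congr' ?_
    obtain ⟨K, hK⟩ := exists_nat_gt ‖x‖
    filter_upwards [eventually_ge_atTop K] with k hk
    rw [hsapp, indicator_of_mem]
    rw [mem_ball_zero_iff]
    exact hK.trans_le (by exact_mod_cast hk)
  have hvol : ∀ k, ∀ y ≠ 0, volume (s k ⁻¹' {y}) ≠ ∞ := by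
    intro k y hy
    refine ne_top_of_le_ne_top (measure_ball_lt_top (x := (0 : Plane)) (r := k)).ne
      (measure_mono fun x hx => ?_)
    by_contra h
    rw [mem_preimage, mem_singleton_iff, hsapp, indicator_of_notMem h] at hx
    exact hy hx.symm
  have h1 := fun k => hX.laplace_simpleFunc hlam (s k) (hvol k)
  have hL : Tendsto (fun k => ∫⁻ ω, expNeg (∑' n, s k (X n ω)) ∂μ) atTop
      (𝓝 (∫⁻ ω, expNeg (∑' n, f (X n ω)) ∂μ)) := by
    refine tendsto_lintegral_of_dominated_convergence (fun _ => 1)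
      (fun k => measurable_expNeg.comp (hX.measurable_tsum (s k).measurable))
      (fun k => ae_of_all _ fun ω => expNeg_le_one _) (by simp) (ae_of_all _ fun ω => ?_)
    refine (continuous_expNeg.tendsto _).comp ?_
    exact tendsto_tsum_of_monotone (fun n => hmono _) fun n => hlim _
  have hR : Tendsto (fun k => expNeg (ENNReal.ofReal lam * ∫⁻ x, (1 - expNeg (s k x)))) atTop
      (𝓝 (expNeg (ENNReal.ofReal lam * ∫⁻ x, (1 - expNeg (f x))))) := by
    refine (continuous_expNeg.tendsto _).comp (ENNReal.Tendsto.const_mul ?_ (.inr (by simp)))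
    refine lintegral_tendsto_of_tendsto_of_monotone (fun k => by fun_prop)
      (ae_of_all _ fun x k l hkl => tsub_le_tsub_left (expNeg_antitone (hmono x hkl)) _)
      (ae_of_all _ fun x => ?_)
    exact ENNReal.Tendsto.sub tendsto_const_nhds ((continuous_expNeg.tendsto _).comp (hlim x))
      (.inl (by simp))
  simp_rw [h1] at hL
  exact tendsto_nhds_unique hL hR

end Poisson

/-! ### The Mecke formula -/

/-- The difference quotient of `1 - exp (-t ε)` at `ε = 0`, squeezed between `t / (1 + t ε)` and
`t`. The argument `t` may vary with `k`, so that the limit can be applied to one such quotient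
nested in another. -/
lemma tendsto_mul_one_sub_expNeg {t : ℕ → ℝ} {t₀ : ℝ} (ht : ∀ k, 0 ≤ t k)
    (hlim : Tendsto t atTop (𝓝 t₀)) :
    Tendsto (fun k : ℕ => ENNReal.ofReal (k + 1) *
      (1 - expNeg (ENNReal.ofReal (t k * (1 / (k + 1 : ℝ)))))) atTop (𝓝 (ENNReal.ofReal t₀)) := by
  have h1 : ∀ k : ℕ, ENNReal.ofReal (k + 1) *
      (1 - expNeg (ENNReal.ofReal (t k * (1 / (k + 1 : ℝ))))) =
      ENNReal.ofReal ((k + 1) * (1 - Real.exp (-(t k * (1 / (k + 1 : ℝ)))))) := by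
    intro k
    rw [expNeg_ofReal (mul_nonneg (ht k) (by positivity)), ENNReal.ofReal_mul (by positivity),
      ENNReal.ofReal_sub _ (by positivity), ENNReal.ofReal_one]
  simp_rw [h1]
  refine ENNReal.tendsto_ofReal ?_
  have h2 : Tendsto (fun k : ℕ => t k / (1 + t k * (1 / (k + 1 : ℝ)))) atTop (𝓝 t₀) := by
    have := hlim.div ((hlim.mul tendsto_one_div_add_atTop_nhds_zero_nat).const_add 1) (by simp)
    rw [mul_zero, add_zero, div_one] at this
    exact this
  refine tendsto_of_tendsto_of_tendsto_of_le_of_le h2 hlim (fun k => ?_) (fun k => ?_)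
  · have hk : (0 : ℝ) < k + 1 := by positivity
    set x := t k * (1 / (k + 1 : ℝ)) with hx
    have hx0 : 0 ≤ x := mul_nonneg (ht k) (by positivity)
    have htk : t k = (k + 1) * x := by rw [hx]; field_simp
    have h3 : Real.exp (-x) ≤ 1 / (1 + x) := by
      rw [Real.exp_neg, ← one_div]
      exact one_div_le_one_div_of_le (by linarith) (by linarith [Real.add_one_le_exp x])
    have h4 : t k / (1 + x) = (k + 1) * (1 - 1 / (1 + x)) := by
      rw [htk]; field_simp; ring
    simp only [h4]
    gcongr
  · have hk : (0 : ℝ) < k + 1 := by positivity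
    have h3 := Real.one_sub_le_exp_neg (t k * (1 / (k + 1 : ℝ)))
    calc (k + 1 : ℝ) * (1 - Real.exp (-(t k * (1 / (k + 1 : ℝ)))))
        ≤ (k + 1) * (t k * (1 / (k + 1 : ℝ))) := by gcongr; linarith
      _ = t k := by field_simp

/-- The domination that accompanies the preceding limit, from `1 - exp (-u) ≤ u`. -/
lemma ofReal_mul_one_sub_expNeg_le (k : ℕ) (t : ℝ≥0∞) :
    ENNReal.ofReal (k + 1) * (1 - expNeg (ENNReal.ofReal (1 / (k + 1 : ℝ)) * t)) ≤ t := by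
  induction t with
  | top => simp
  | coe t =>
    rw [← ENNReal.ofReal_coe_nnreal, ← ENNReal.ofReal_mul (by positivity),
      expNeg_ofReal (by positivity), ← ENNReal.ofReal_one, ← ENNReal.ofReal_sub _ (by positivity),
      ← ENNReal.ofReal_mul (by positivity)]
    refine ENNReal.ofReal_le_ofReal ?_
    have h3 := Real.one_sub_le_exp_neg (1 / (k + 1 : ℝ) * t)
    calc (k + 1 : ℝ) * (1 - Real.exp (-(1 / (k + 1 : ℝ) * t)))
        ≤ (k + 1) * (1 / (k + 1 : ℝ) * t) := by gcongr; linarith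
      _ = t := by field_simp

section Poisson

variable {Ω : Type*} [MeasurableSpace Ω] {μ : Measure Ω} {lam : ℝ} {X : ℕ → Ω → Plane}

/-- The difference of the Laplace functional at `f` and at `f` plus `ε` times the indicator of `A`.
The perturbation adds `lam (1 - exp (-ε)) ∫_A exp (-f)` to the exponent. -/
lemma IsHPPP.lintegral_mul_one_sub_expNeg [IsProbabilityMeasure μ] (hX : IsHPPP μ lam X)
    (hlam : 0 ≤ lam) {f : Plane → ℝ≥0∞} (hf : Measurable f) {A : Set Plane} (hA : MeasurableSet A)
    (ε : ℝ≥0∞) :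
    ∫⁻ ω, expNeg (∑' n, f (X n ω)) * (1 - expNeg (ε * pointCount X A ω)) ∂μ =
      expNeg (ENNReal.ofReal lam * ∫⁻ x, (1 - expNeg (f x))) *
        (1 - expNeg (ENNReal.ofReal lam * ((∫⁻ x in A, expNeg (f x)) * (1 - expNeg ε)))) := by
  have hpt : ∀ ω, expNeg (∑' n, f (X n ω)) * (1 - expNeg (ε * pointCount X A ω)) =
      expNeg (∑' n, f (X n ω)) - expNeg (∑' n, (f (X n ω) + A.indicator (fun _ => ε) (X n ω))) := by
    intro ω
    rw [ENNReal.tsum_add, expNeg_add, tsum_indicator_const_mul, ENNReal.mul_sub, mul_one]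
    exact fun _ _ => expNeg_ne_top _
  have hmeas : Measurable fun x => f x + A.indicator (fun _ => ε) x :=
    hf.add (measurable_const.indicator hA)
  have hint : ∫⁻ x, (1 - expNeg (f x + A.indicator (fun _ => ε) x)) =
      (∫⁻ x, (1 - expNeg (f x))) + (∫⁻ x in A, expNeg (f x)) * (1 - expNeg ε) := by
    rw [← lintegral_mul_const _ (by fun_prop), ← lintegral_indicator hA,
      ← lintegral_add_left (by fun_prop)]
    refine lintegral_congr fun x => ?_
    by_cases hx : x ∈ A
    · rw [indicator_of_mem hx, indicator_of_mem hx, expNeg_add, ENNReal.mul_sub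
        (fun _ _ => expNeg_ne_top _), mul_one]
      exact (tsub_add_tsub_cancel (expNeg_le_one _)
        (mul_le_of_le_one_right' (expNeg_le_one _))).symm
    · simp [hx]
  simp_rw [hpt]
  rw [lintegral_sub (show Measurable fun ω => expNeg _ from
      measurable_expNeg.comp (hX.measurable_tsum hmeas)),
    hX.laplace hlam hf, hX.laplace hlam hmeas, hint, mul_add, expNeg_add,
    ENNReal.mul_sub (fun _ _ => expNeg_ne_top _), mul_one]
  · refine ne_top_of_le_ne_top (b := 1) (by simp) ?_
    calc _ ≤ ∫⁻ _, 1 ∂μ := lintegral_mono fun ω => expNeg_le_one _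
      _ = 1 := by simp
  · exact ae_of_all _ fun ω => expNeg_antitone (ENNReal.tsum_le_tsum fun n => le_self_add)

/-- The derivative at `ε = 0` of the preceding identity, taken along `ε = 1 / (k + 1)`. On the left
the limit passes under the expectation because the quotients are dominated by the count in `A`,
which has finite mean. -/
lemma IsHPPP.lintegral_pointCount_mul_expNeg [IsProbabilityMeasure μ] (hX : IsHPPP μ lam X)
    (hlam : 0 ≤ lam) {f : Plane → ℝ≥0∞} (hf : Measurable f) {A : Set Plane} (hA : MeasurableSet A)
    (hA' : volume A ≠ ∞) :
    ∫⁻ ω, pointCount X A ω * expNeg (∑' n, f (X n ω)) ∂μ =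
      ENNReal.ofReal lam * (∫⁻ x in A, expNeg (f x)) *
        expNeg (ENNReal.ofReal lam * ∫⁻ x, (1 - expNeg (f x))) := by
  have hN : ∫⁻ ω, pointCount X A ω ∂μ ≠ ∞ := by
    rw [hX.lintegral_pointCount hlam hA hA']
    exact ENNReal.mul_ne_top (by simp) hA'
  have hmD := measurable_expNeg.comp (hX.measurable_tsum hf)
  have hmN := hX.measurable_pointCount hA
  simp only [Function.comp_def] at hmD
  have hc : ∫⁻ x in A, expNeg (f x) ≠ ∞ := by
    refine ne_top_of_le_ne_top hA' ?_
    calc _ ≤ ∫⁻ _ in A, 1 := lintegral_mono fun ω => expNeg_le_one _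
      _ = volume A := by simp
  set c := (∫⁻ x in A, expNeg (f x)).toReal with hc_def
  have hcc : ∫⁻ x in A, expNeg (f x) = ENNReal.ofReal c := (ENNReal.ofReal_toReal hc).symm
  have hc0 : 0 ≤ c := ENNReal.toReal_nonneg
  set ε : ℕ → ℝ := fun k => 1 / (k + 1 : ℝ) with hε
  have hε0 : ∀ k, 0 ≤ ε k := fun k => by positivity
  have hleft : Tendsto (fun k : ℕ => ∫⁻ ω, ENNReal.ofReal (k + 1) * (expNeg (∑' n, f (X n ω)) *
      (1 - expNeg (ENNReal.ofReal (ε k) * pointCount X A ω))) ∂μ) atTop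
      (𝓝 (∫⁻ ω, pointCount X A ω * expNeg (∑' n, f (X n ω)) ∂μ)) := by
    refine tendsto_lintegral_of_dominated_convergence (pointCount X A) (fun k => by fun_prop)
      (fun k => ae_of_all _ fun ω => ?_) hN ?_
    · calc _ = expNeg (∑' n, f (X n ω)) * (ENNReal.ofReal (k + 1) *
            (1 - expNeg (ENNReal.ofReal (ε k) * pointCount X A ω))) := by ring
        _ ≤ 1 * pointCount X A ω :=
            mul_le_mul' (expNeg_le_one _) (ofReal_mul_one_sub_expNeg_le k _)
        _ = _ := one_mul _
    · filter_upwards [ae_lt_top hmN hN] with ω hω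
      have h1 := tendsto_mul_one_sub_expNeg (t := fun _ => (pointCount X A ω).toReal)
        (fun _ => ENNReal.toReal_nonneg) tendsto_const_nhds
      have h2 := ENNReal.Tendsto.mul_const (b := expNeg (∑' n, f (X n ω))) h1
        (.inr (expNeg_ne_top _))
      rw [ENNReal.ofReal_toReal hω.ne] at h2
      refine h2.congr fun k => ?_
      rw [mul_comm _ (1 / (k + 1 : ℝ)), ENNReal.ofReal_mul (by positivity),
        ENNReal.ofReal_toReal hω.ne]
      ring
  have hright : Tendsto (fun k : ℕ => ENNReal.ofReal (k + 1) *
      (expNeg (ENNReal.ofReal lam * ∫⁻ x, (1 - expNeg (f x))) *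
        (1 - expNeg (ENNReal.ofReal lam * ((∫⁻ x in A, expNeg (f x)) *
          (1 - expNeg (ENNReal.ofReal (ε k)))))))) atTop
      (𝓝 (ENNReal.ofReal lam * (∫⁻ x in A, expNeg (f x)) *
        expNeg (ENNReal.ofReal lam * ∫⁻ x, (1 - expNeg (f x))))) := by
    have h0 : Tendsto (fun k : ℕ => (k + 1 : ℝ) * (1 - Real.exp (-(ε k)))) atTop (𝓝 1) := by
      have h := tendsto_mul_one_sub_expNeg (t := fun _ => 1) (t₀ := 1) (by simp) tendsto_const_nhds
      have h' := (ENNReal.tendsto_toReal (by simp)).comp h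
      refine (h'.congr fun k => ?_).trans (by simp)
      rw [Function.comp_apply, one_mul, expNeg_ofReal (hε0 k), ← ENNReal.ofReal_one,
        ← ENNReal.ofReal_sub _ (by positivity), ← ENNReal.ofReal_mul (by positivity),
        ENNReal.toReal_ofReal]
      have : Real.exp (-ε k) ≤ 1 := Real.exp_le_one_iff.2 (by linarith [hε0 k])
      exact mul_nonneg (by positivity) (by linarith)
    have hpos : ∀ k : ℕ, 0 ≤ 1 - Real.exp (-(ε k)) := fun k => by
      have : Real.exp (-ε k) ≤ 1 := Real.exp_le_one_iff.2 (by linarith [hε0 k])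
      linarith
    -- The outer exponent is `lam c (1 - exp (-ε))`; written as `ε` times a convergent factor, it
    -- has the form of the difference quotient with varying argument.
    have h1 := tendsto_mul_one_sub_expNeg
      (t := fun k : ℕ => lam * c * ((k + 1 : ℝ) * (1 - Real.exp (-(ε k))))) (t₀ := lam * c)
      (fun k => mul_nonneg (mul_nonneg hlam hc0) (mul_nonneg (by positivity) (hpos k)))
      (by simpa using h0.const_mul (lam * c))
    have h2 := ENNReal.Tendsto.mul_const
      (b := expNeg (ENNReal.ofReal lam * ∫⁻ x, (1 - expNeg (f x)))) h1 (.inr (expNeg_ne_top _))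
    rw [ENNReal.ofReal_mul hlam, ← hcc] at h2
    refine h2.congr fun k => ?_
    have h3 : ENNReal.ofReal (lam * c * ((k + 1 : ℝ) * (1 - Real.exp (-(ε k)))) *
        (1 / (k + 1 : ℝ))) = ENNReal.ofReal lam * ((∫⁻ x in A, expNeg (f x)) *
          (1 - expNeg (ENNReal.ofReal (ε k)))) := by
      rw [hcc, expNeg_ofReal (hε0 k), ← ENNReal.ofReal_one, ← ENNReal.ofReal_sub _ (by positivity),
        ← ENNReal.ofReal_mul hc0, ← ENNReal.ofReal_mul hlam]
      congr 1
      field_simp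
    rw [h3]
    ring
  refine tendsto_nhds_unique hleft (hright.congr fun k => ?_)
  rw [lintegral_const_mul _ (by fun_prop), hX.lintegral_mul_one_sub_expNeg hlam hf hA]

end Poisson

/-! ### Dyadic discretisation of the radius -/

/-- The radius `r`, rounded down to a multiple of `2⁻ᵏ`. -/
def roundDown (k : ℕ) (r : ℝ) : ℝ := ⌊2 ^ k * r⌋₊ / 2 ^ k

lemma roundDown_nonneg (k : ℕ) (r : ℝ) : 0 ≤ roundDown k r := by
  unfold roundDown; positivity

lemma roundDown_le (k : ℕ) {r : ℝ} (hr : 0 ≤ r) : roundDown k r ≤ r := by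
  rw [roundDown, div_le_iff₀ (by positivity), mul_comm r]
  exact Nat.floor_le (by positivity)

lemma monotone_roundDown {r : ℝ} (hr : 0 ≤ r) : Monotone fun k => roundDown k r := by
  refine monotone_nat_of_le_succ fun k => ?_
  simp only [roundDown]
  rw [div_le_div_iff₀ (by positivity) (by positivity), pow_succ, mul_comm _ (2 : ℝ), ← mul_assoc]
  refine mul_le_mul_of_nonneg_right ?_ (by positivity)
  have h : ⌊2 ^ k * r⌋₊ * 2 ≤ ⌊2 * 2 ^ k * r⌋₊ := by
    refine Nat.le_floor ?_
    have := Nat.floor_le (a := 2 ^ k * r) (by positivity)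
    push_cast
    linarith
  exact_mod_cast h

lemma tendsto_roundDown {r : ℝ} (hr : 0 ≤ r) : Tendsto (fun k => roundDown k r) atTop (𝓝 r) := by
  have h : Tendsto (fun k : ℕ => r - (1 / 2 : ℝ) ^ k) atTop (𝓝 r) := by
    simpa using (tendsto_pow_atTop_nhds_zero_of_lt_one (r := (1 / 2 : ℝ)) (by norm_num)
      (by norm_num)).const_sub r
  refine tendsto_of_tendsto_of_tendsto_of_le_of_le h tendsto_const_nhds (fun k => ?_)
    fun k => roundDown_le k hr
  have h1 := (Nat.lt_floor_add_one (2 ^ k * r)).le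
  simp only [roundDown]
  rw [le_div_iff₀ (by positivity), sub_mul, ← mul_pow]
  norm_num
  linarith

/-- Rounding approaches `r` from below, so left continuity is enough. This matters because the
weights used later jump at the radius of a station. -/
lemma tendsto_comp_roundDown {g : ℝ → ℝ≥0∞} {r : ℝ} (hr : 0 ≤ r)
    (hg : ContinuousWithinAt g (Iic r) r) : Tendsto (fun k => g (roundDown k r)) atTop (𝓝 (g r)) :=
  hg.tendsto.comp (tendsto_nhdsWithin_iff.2
    ⟨tendsto_roundDown hr, Eventually.of_forall fun k => roundDown_le k hr⟩)

section Poisson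

variable {Ω : Type*} [MeasurableSpace Ω] {μ : Measure Ω} {lam : ℝ} {X : ℕ → Ω → Plane}

/-- When the functional depends on the distinguished point only through a countable label `J`, the
set `A` splits into cells on which it is constant. On each cell the formula for a count times an
exponential applies. -/
lemma IsHPPP.lintegral_tsum_indicator_mul_of_countable [IsProbabilityMeasure μ]
    (hX : IsHPPP μ lam X) (hlam : 0 ≤ lam) {a : ℝ → ℝ≥0∞} {F : ℝ → Plane → ℝ≥0∞}
    (hF : ∀ r, Measurable (F r)) {A : Set Plane} (hA : MeasurableSet A) (hA' : volume A ≠ ∞)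
    {J : Plane → ℕ} (hJ : Measurable J) (ρ : ℕ → ℝ) :
    ∫⁻ ω, ∑' n, A.indicator (fun x => expNeg (a (ρ (J x)) + ∑' m, F (ρ (J x)) (X m ω))) (X n ω) ∂μ =
      ENNReal.ofReal lam * ∫⁻ x in A, expNeg (a (ρ (J x)) + F (ρ (J x)) x +
        ENNReal.ofReal lam * ∫⁻ y, (1 - expNeg (F (ρ (J x)) y))) := by
  have hmJ : ∀ j, MeasurableSet (A ∩ J ⁻¹' {j}) := fun j => hA.inter (hJ (measurableSet_singleton j))
  have hdisj : Pairwise fun i j => Disjoint (A ∩ J ⁻¹' {i}) (A ∩ J ⁻¹' {j}) := fun i j hij =>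
    ((disjoint_singleton.2 hij).preimage J).mono inter_subset_right inter_subset_right
  have hunion : A = ⋃ j, A ∩ J ⁻¹' {j} := by
    ext x
    simp
  calc _ = ∫⁻ ω, ∑' j, expNeg (a (ρ j)) *
        (pointCount X (A ∩ J ⁻¹' {j}) ω * expNeg (∑' m, F (ρ j) (X m ω))) ∂μ := by
        refine lintegral_congr fun ω => ?_
        have h1 : ∀ j, expNeg (a (ρ j)) * (pointCount X (A ∩ J ⁻¹' {j}) ω *
            expNeg (∑' m, F (ρ j) (X m ω))) = ∑' n, (A ∩ J ⁻¹' {j}).indicator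
              (fun _ => expNeg (a (ρ j) + ∑' m, F (ρ j) (X m ω))) (X n ω) := by
          intro j
          rw [tsum_indicator_const_mul, expNeg_add]
          ring
        simp_rw [h1]
        rw [ENNReal.tsum_comm]
        refine tsum_congr fun n => ?_
        rw [tsum_eq_single (J (X n ω))]
        · by_cases hn : X n ω ∈ A <;> simp [hn]
        · intro j hj
          rw [indicator_of_notMem]
          exact fun h => hj h.2.symm
    _ = ∑' j, expNeg (a (ρ j)) * (ENNReal.ofReal lam * (∫⁻ x in A ∩ J ⁻¹' {j}, expNeg (F (ρ j) x)) *
        expNeg (ENNReal.ofReal lam * ∫⁻ y, (1 - expNeg (F (ρ j) y)))) := by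
        have hm : ∀ j, Measurable fun ω => pointCount X (A ∩ J ⁻¹' {j}) ω *
            expNeg (∑' m, F (ρ j) (X m ω)) := fun j =>
          (hX.measurable_pointCount (hmJ j)).mul
            (measurable_expNeg.comp (hX.measurable_tsum (hF _)))
        rw [lintegral_tsum fun j => ((hm j).const_mul _).aemeasurable]
        refine tsum_congr fun j => ?_
        rw [lintegral_const_mul _ (hm j), hX.lintegral_pointCount_mul_expNeg hlam (hF _) (hmJ j)
          (ne_top_of_le_ne_top hA' (measure_mono inter_subset_left))]
    _ = _ := by
        conv_rhs => rw [hunion, lintegral_iUnion hmJ hdisj, ← ENNReal.tsum_mul_left]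
        refine tsum_congr fun j => ?_
        have h2 : ∫⁻ x in A ∩ J ⁻¹' {j}, expNeg (a (ρ (J x)) + F (ρ (J x)) x +
            ENNReal.ofReal lam * ∫⁻ y, (1 - expNeg (F (ρ (J x)) y))) =
            ∫⁻ x in A ∩ J ⁻¹' {j}, expNeg (F (ρ j) x) * (expNeg (a (ρ j)) *
              expNeg (ENNReal.ofReal lam * ∫⁻ y, (1 - expNeg (F (ρ j) y)))) := by
          refine setLIntegral_congr_fun (hmJ j) fun x hx => ?_
          have hxj : J x = j := hx.2
          simp only [hxj, expNeg_add]
          ring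
        rw [h2, lintegral_mul_const _ (show Measurable fun x => expNeg _ from
          measurable_expNeg.comp (hF _))]
        ring

lemma measurable_indicator_expNeg (hX : ∀ n, Measurable (X n)) {a : ℝ → ℝ≥0∞}
    {F : ℝ → Plane → ℝ≥0∞} (ha : Measurable a) (hF : Measurable (Function.uncurry F))
    {A : Set Plane} (hA : MeasurableSet A) {ρ : Plane → ℝ} (hρ : Measurable ρ) (n : ℕ) :
    Measurable fun ω =>
      A.indicator (fun x => expNeg (a (ρ x) + ∑' m, F (ρ x) (X m ω))) (X n ω) := by
  have h1 : Measurable fun ω => expNeg (a (ρ (X n ω)) + ∑' m, F (ρ (X n ω)) (X m ω)) := by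
    refine measurable_expNeg.comp ((ha.comp (hρ.comp (hX n))).add ?_)
    exact Measurable.tsum fun m => hF.comp ((hρ.comp (hX n)).prodMk (hX m))
  exact h1.indicator (hX n hA)

/-- The Mecke formula for functionals `exp (-a(‖x‖) - ∑ F(‖x‖, X m))` in which `a` and `F` are
increasing and left-continuous functions of the radius `‖x‖`. -/
theorem IsHPPP.mecke_radial [IsProbabilityMeasure μ] (hX : IsHPPP μ lam X) (hlam : 0 ≤ lam)
    {a : ℝ → ℝ≥0∞} {F : ℝ → Plane → ℝ≥0∞} (ha : Measurable a)
    (hF : Measurable (Function.uncurry F)) (ha' : ∀ r, ContinuousWithinAt a (Iic r) r)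
    (hF' : ∀ r y, ContinuousWithinAt (fun s => F s y) (Iic r) r)
    (hmono : ∀ y, MonotoneOn (fun s => F s y) (Ici 0))
    {A : Set Plane} (hA : MeasurableSet A) (hA' : volume A ≠ ∞) :
    ∫⁻ ω, ∑' n, A.indicator (fun x => expNeg (a ‖x‖ + ∑' m, F ‖x‖ (X m ω))) (X n ω) ∂μ =
      ENNReal.ofReal lam * ∫⁻ x in A, expNeg (a ‖x‖ + F ‖x‖ x +
        ENNReal.ofReal lam * ∫⁻ y, (1 - expNeg (F ‖x‖ y))) := by
  have hFr : ∀ r, Measurable (F r) := fun r => hF.comp measurable_prodMk_left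
  have hmonoR : ∀ x y : Plane, Monotone fun k => F (roundDown k ‖x‖) y := fun x y k l hkl =>
    hmono y (roundDown_nonneg _ _) (roundDown_nonneg _ _) (monotone_roundDown (norm_nonneg x) hkl)
  have hlimR : ∀ x y : Plane, Tendsto (fun k => F (roundDown k ‖x‖) y) atTop (𝓝 (F ‖x‖ y)) :=
    fun x y => tendsto_comp_roundDown (norm_nonneg x) (hF' _ y)
  have hround : ∀ k, Measurable fun x : Plane => roundDown k ‖x‖ := fun k => by
    unfold roundDown
    have : Measurable fun x : Plane => ⌊2 ^ k * ‖x‖⌋₊ := Nat.measurable_floor.comp (by fun_prop)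
    exact (measurable_from_nat.comp this).div_const _
  -- The label is the integer `⌊2ᵏ ‖x‖⌋`, which determines the rounded radius.
  have hstep : ∀ k : ℕ,
      ∫⁻ ω, ∑' n, A.indicator (fun x => expNeg (a (roundDown k ‖x‖) +
        ∑' m, F (roundDown k ‖x‖) (X m ω))) (X n ω) ∂μ =
      ENNReal.ofReal lam * ∫⁻ x in A, expNeg (a (roundDown k ‖x‖) + F (roundDown k ‖x‖) x +
        ENNReal.ofReal lam * ∫⁻ y, (1 - expNeg (F (roundDown k ‖x‖) y))) := fun k =>
    hX.lintegral_tsum_indicator_mul_of_countable hlam hFr hA hA'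
      (J := fun x => ⌊2 ^ k * ‖x‖⌋₊) (Nat.measurable_floor.comp (by fun_prop))
      (fun j => j / 2 ^ k)
  have hmeas := fun (ρ : Plane → ℝ) (hρ : Measurable ρ) (n : ℕ) =>
    measurable_indicator_expNeg hX.measurable ha hF hA hρ n
  have hleft : Tendsto (fun k => ∫⁻ ω, ∑' n, A.indicator (fun x => expNeg (a (roundDown k ‖x‖) +
        ∑' m, F (roundDown k ‖x‖) (X m ω))) (X n ω) ∂μ) atTop
      (𝓝 (∫⁻ ω, ∑' n, A.indicator (fun x => expNeg (a ‖x‖ + ∑' m, F ‖x‖ (X m ω))) (X n ω) ∂μ)) := by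
    -- Sum and expectation are merged into one integral over `ℕ × Ω`, so that a single dominated
    -- convergence suffices; the majorant is the indicator of `X n ∈ A`, with finite total mass.
    have hcount : ∀ g : ℕ → Ω → ℝ≥0∞, (∀ n, Measurable (g n)) →
        ∫⁻ ω, ∑' n, g n ω ∂μ = ∫⁻ q, g q.1 q.2 ∂(Measure.count.prod μ) := by
      intro g hg
      rw [lintegral_prod _ (measurable_from_prod_countable_right hg).aemeasurable, lintegral_count,
        lintegral_tsum fun n => (hg n).aemeasurable]
    rw [hcount _ (hmeas _ measurable_norm)]
    simp_rw [fun k => hcount _ (hmeas _ (hround k))]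
    refine tendsto_lintegral_of_dominated_convergence
      (fun q : ℕ × Ω => A.indicator (fun _ => 1) (X q.1 q.2))
      (fun k => measurable_from_prod_countable_right (hmeas _ (hround k)))
      (fun k => ae_of_all _ fun q => indicator_le_indicator (expNeg_le_one _)) ?_
      (ae_of_all _ fun q => ?_)
    · rw [← hcount (fun n ω => A.indicator (fun _ => 1) (X n ω))
        (fun n => (measurable_const.indicator hA).comp (hX.measurable n))]
      have := hX.lintegral_pointCount hlam hA hA'
      simp only [pointCount] at this
      rw [this]
      exact ENNReal.mul_ne_top (by simp) hA'
    · by_cases hq : X q.1 q.2 ∈ A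
      · simp only [indicator_of_mem hq]
        exact (continuous_expNeg.tendsto _).comp
          ((tendsto_comp_roundDown (norm_nonneg _) (ha' _)).add
            (tendsto_tsum_of_monotone (fun m => hmonoR _ _) fun m => hlimR _ _))
      · simp only [indicator_of_notMem hq]
        exact tendsto_const_nhds
  have hright : Tendsto (fun k => ENNReal.ofReal lam * ∫⁻ x in A, expNeg (a (roundDown k ‖x‖) +
        F (roundDown k ‖x‖) x + ENNReal.ofReal lam * ∫⁻ y, (1 - expNeg (F (roundDown k ‖x‖) y))))
      atTop (𝓝 (ENNReal.ofReal lam * ∫⁻ x in A, expNeg (a ‖x‖ + F ‖x‖ x +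
        ENNReal.ofReal lam * ∫⁻ y, (1 - expNeg (F ‖x‖ y))))) := by
    refine ENNReal.Tendsto.const_mul ?_ (.inr (by simp))
    refine tendsto_lintegral_of_dominated_convergence (fun _ => 1) (fun k => ?_)
      (fun k => ae_of_all _ fun x => expNeg_le_one _) (by simpa using hA') (ae_of_all _ fun x => ?_)
    · refine measurable_expNeg.comp (((ha.comp (hround k)).add
        (hF.comp ((hround k).prodMk measurable_id))).add (Measurable.const_mul ?_ _))
      refine Measurable.lintegral_prod_right' (f := fun q : Plane × Plane =>
        1 - expNeg (F (roundDown k ‖q.1‖) q.2)) ?_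
      exact (measurable_expNeg.comp (hF.comp (((hround k).comp measurable_fst).prodMk
        measurable_snd))).const_sub 1
    · refine (continuous_expNeg.tendsto _).comp
        (((tendsto_comp_roundDown (norm_nonneg _) (ha' _)).add (hlimR _ _)).add
          (ENNReal.Tendsto.const_mul ?_ (.inr (by simp))))
      refine lintegral_tendsto_of_tendsto_of_monotone
        (fun k => ((measurable_expNeg.comp (hFr _)).const_sub 1).aemeasurable)
        (ae_of_all _ fun y k l hkl => tsub_le_tsub_left (expNeg_antitone (hmonoR x y hkl)) _)
        (ae_of_all _ fun y => ?_)
      exact ENNReal.Tendsto.sub tendsto_const_nhds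
        ((continuous_expNeg.tendsto _).comp (hlimR x y)) (.inl (by simp))
  exact tendsto_nhds_unique hleft (hright.congr fun k => (hstep k).symm)

/-- The Mecke formula `mecke_radial` on the whole plane. -/
theorem IsHPPP.mecke_radial_univ [IsProbabilityMeasure μ] (hX : IsHPPP μ lam X) (hlam : 0 ≤ lam)
    {a : ℝ → ℝ≥0∞} {F : ℝ → Plane → ℝ≥0∞} (ha : Measurable a)
    (hF : Measurable (Function.uncurry F)) (ha' : ∀ r, ContinuousWithinAt a (Iic r) r)
    (hF' : ∀ r y, ContinuousWithinAt (fun s => F s y) (Iic r) r)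
    (hmono : ∀ y, MonotoneOn (fun s => F s y) (Ici 0)) :
    ∫⁻ ω, ∑' n, expNeg (a ‖X n ω‖ + ∑' m, F ‖X n ω‖ (X m ω)) ∂μ =
      ENNReal.ofReal lam * ∫⁻ x : Plane, expNeg (a ‖x‖ + F ‖x‖ x +
        ENNReal.ofReal lam * ∫⁻ y, (1 - expNeg (F ‖x‖ y))) := by
  have hball : ∀ k : ℕ, MeasurableSet (Metric.ball (0 : Plane) k) := fun k =>
    Metric.isOpen_ball.measurableSet
  have hind : ∀ (g : Plane → ℝ≥0∞) (x : Plane),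
      Tendsto (fun k : ℕ => (Metric.ball (0 : Plane) k).indicator g x) atTop (𝓝 (g x)) := by
    intro g x
    obtain ⟨K, hK⟩ := exists_nat_gt ‖x‖
    refine tendsto_const_nhds.congr' ?_
    filter_upwards [eventually_ge_atTop K] with k hk
    rw [indicator_of_mem]
    rw [mem_ball_zero_iff]
    exact hK.trans_le (by exact_mod_cast hk)
  have hindm : ∀ (g : Plane → ℝ≥0∞) (x : Plane),
      Monotone fun k : ℕ => (Metric.ball (0 : Plane) k).indicator g x := fun g x k l hkl =>
    indicator_le_indicator_of_subset (Metric.ball_subset_ball (by exact_mod_cast hkl))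
      (fun _ => zero_le) x
  have hstep := fun k : ℕ =>
    hX.mecke_radial hlam ha hF ha' hF' hmono (hball k) measure_ball_lt_top.ne
  have hL : Tendsto (fun k : ℕ => ∫⁻ ω, ∑' n, (Metric.ball (0 : Plane) k).indicator
      (fun x => expNeg (a ‖x‖ + ∑' m, F ‖x‖ (X m ω))) (X n ω) ∂μ) atTop
      (𝓝 (∫⁻ ω, ∑' n, expNeg (a ‖X n ω‖ + ∑' m, F ‖X n ω‖ (X m ω)) ∂μ)) := by
    refine lintegral_tendsto_of_tendsto_of_monotone (fun k => ?_) (ae_of_all _ fun ω k l hkl => ?_)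
      (ae_of_all _ fun ω => ?_)
    · exact (Measurable.tsum fun n => measurable_indicator_expNeg hX.measurable ha hF (hball k)
        measurable_norm n).aemeasurable
    · exact ENNReal.tsum_le_tsum fun n => hindm _ _ hkl
    · exact tendsto_tsum_of_monotone (fun n => hindm _ _)
        fun n => hind (fun x => expNeg (a ‖x‖ + ∑' m, F ‖x‖ (X m ω))) _
  have hR : Tendsto (fun k : ℕ => ENNReal.ofReal lam * ∫⁻ x in Metric.ball (0 : Plane) k,
      expNeg (a ‖x‖ + F ‖x‖ x + ENNReal.ofReal lam * ∫⁻ y, (1 - expNeg (F ‖x‖ y)))) atTop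
      (𝓝 (ENNReal.ofReal lam * ∫⁻ x : Plane, expNeg (a ‖x‖ + F ‖x‖ x +
        ENNReal.ofReal lam * ∫⁻ y, (1 - expNeg (F ‖x‖ y))))) := by
    refine ENNReal.Tendsto.const_mul ?_ (.inr (by simp))
    simp_rw [fun k : ℕ => (lintegral_indicator (μ := volume) (hball k) (fun x : Plane =>
      expNeg (a ‖x‖ + F ‖x‖ x + ENNReal.ofReal lam * ∫⁻ y, (1 - expNeg (F ‖x‖ y))))).symm]
    refine lintegral_tendsto_of_tendsto_of_monotone (fun k => ?_)
      (ae_of_all _ fun x => hindm _ _) (ae_of_all _ fun x => hind _ _)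
    refine (Measurable.indicator ?_ (hball k)).aemeasurable
    refine measurable_expNeg.comp (((ha.comp measurable_norm).add
      (hF.comp (measurable_norm.prodMk measurable_id))).add (Measurable.const_mul ?_ _))
    refine Measurable.lintegral_prod_right' (f := fun q : Plane × Plane =>
      1 - expNeg (F ‖q.1‖ q.2)) ?_
    exact (measurable_expNeg.comp (hF.comp ((measurable_norm.comp measurable_fst).prodMk
      measurable_snd))).const_sub 1
  exact tendsto_nhds_unique hL (hR.congr fun k => (hstep k).symm)

/-! ### Simplicity of the radii -/

lemma IsHPPP.ae_ne_zero (hX : IsHPPP μ lam X) (hlam : 0 ≤ lam) :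
    ∀ᵐ ω ∂μ, ∀ n, X n ω ≠ 0 := by
  have h := hX.lintegral_pointCount hlam (measurableSet_singleton 0) (by simp)
  rw [measure_singleton, mul_zero,
    lintegral_eq_zero_iff (hX.measurable_pointCount (measurableSet_singleton 0))] at h
  filter_upwards [h] with ω hω n hn
  have := ENNReal.tsum_eq_zero.1 hω n
  simp [hn] at this

/-- For a Poisson count `K` of mean `c = lam v`, the bound `1_{K ≥ 2} + 1_{K ≥ 1} ≤ K` gives `ℙ(K ≥
2) ≤ c - 1 + exp (-c)`, which is at most `c²`. -/
lemma measure_two_le_pointCount_le [IsProbabilityMeasure μ] (hX : IsHPPP μ lam X) (hlam : 0 ≤ lam)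
    {A : Set Plane} (hA : MeasurableSet A) {v : ℝ} (hv : 0 ≤ v)
    (hA' : volume A = ENNReal.ofReal v) :
    μ {ω | 2 ≤ pointCount X A ω} ≤ ENNReal.ofReal ((lam * v) ^ 2) := by
  have hfin : volume A ≠ ∞ := by simp [hA']
  have hc : 0 ≤ lam * v := mul_nonneg hlam hv
  have hS : MeasurableSet {ω | 2 ≤ pointCount X A ω} :=
    measurableSet_le measurable_const (hX.measurable_pointCount hA)
  have hI : MeasurableSet (Ici (2 : ℝ≥0∞)) := measurableSet_Ici
  have h1 : μ {ω | 2 ≤ pointCount X A ω} + (1 - ENNReal.ofReal (Real.exp (-(lam * v)))) ≤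
      ENNReal.ofReal (lam * v) := by
    have e1 := hX.lintegral_comp_pointCount hA hfin
      (g := (Ici (2 : ℝ≥0∞)).indicator 1) (measurable_one.indicator hI)
    -- Since `∞ * 0 = 0`, the function `expNeg (∞ * k)` is the indicator of `k = 0`.
    have e2 : ∫⁻ k : ℕ, (1 - expNeg (∞ * k)) ∂(poissonMeasure (lam * volume.real A).toNNReal) =
        1 - ENNReal.ofReal (Real.exp (-(lam * v))) := by
      rw [lintegral_sub Measurable.of_discrete _
        (ae_of_all _ fun k => expNeg_le_one _), lintegral_expNeg_poissonMeasure,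
        coe_toNNReal_mul_volume hlam hfin, hA', ← ENNReal.ofReal_mul hlam]
      · simp [expNeg_ofReal hc]
      · rw [lintegral_expNeg_poissonMeasure]
        exact expNeg_ne_top _
    have e3 : μ {ω | 2 ≤ pointCount X A ω} =
        ∫⁻ ω, (Ici (2 : ℝ≥0∞)).indicator 1 (pointCount X A ω) ∂μ := by
      rw [← lintegral_indicator_one hS]
      rfl
    have e4 : ENNReal.ofReal (lam * v) =
        ∫⁻ k : ℕ, (k : ℝ≥0∞) ∂(poissonMeasure (lam * volume.real A).toNNReal) := by
      rw [lintegral_natCast_poissonMeasure, coe_toNNReal_mul_volume hlam hfin, hA',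
        ENNReal.ofReal_mul hlam]
    rw [e3, e1, ← e2, e4, ← lintegral_add_left Measurable.of_discrete]
    refine lintegral_mono fun k => ?_
    rcases k with _ | _ | k
    · simp
    · simp
    · have h2 : (2 : ℝ≥0∞) ≤ ((k + 1 + 1 : ℕ) : ℝ≥0∞) := by exact_mod_cast (by omega)
      rw [indicator_of_mem (by exact h2), ENNReal.top_mul (by simp), expNeg_top]
      refine le_trans ?_ h2
      norm_num
  have h2 : 1 - Real.exp (-(lam * v)) ≥ lam * v - (lam * v) ^ 2 := by
    have h3 : Real.exp (-(lam * v)) ≤ 1 / (1 + lam * v) := by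
      rw [Real.exp_neg, ← one_div]
      exact one_div_le_one_div_of_le (by linarith) (by linarith [Real.add_one_le_exp (lam * v)])
    have h4 : 1 / (1 + lam * v) ≤ 1 - lam * v + (lam * v) ^ 2 := by
      rw [div_le_iff₀ (by linarith)]
      nlinarith [pow_nonneg hc 3]
    linarith
  have h3 : μ {ω | 2 ≤ pointCount X A ω} ≠ ∞ := measure_ne_top _ _
  rw [← ENNReal.ofReal_toReal h3, ← ENNReal.ofReal_one, ← ENNReal.ofReal_sub _ (by positivity),
    ← ENNReal.ofReal_add ENNReal.toReal_nonneg (by simpa using hc),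
    ENNReal.ofReal_le_ofReal_iff hc] at h1
  rw [← ENNReal.ofReal_toReal h3]
  exact ENNReal.ofReal_le_ofReal (by linarith)

lemma volume_annulus {s t : ℝ} (hs : 0 ≤ s) (hst : s ≤ t) :
    volume {x : Plane | s ≤ ‖x‖ ^ 2 ∧ ‖x‖ ^ 2 < t} = ENNReal.ofReal (Real.pi * (t - s)) := by
  have hball : ∀ u : ℝ, 0 ≤ u → {x : Plane | ‖x‖ ^ 2 < u} = Metric.ball 0 (√u) := by
    intro u hu
    ext x
    rw [mem_ofPred_eq, mem_ball_zero_iff, Real.lt_sqrt (norm_nonneg x)]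
  have hvol : ∀ u : ℝ, 0 ≤ u →
      volume {x : Plane | ‖x‖ ^ 2 < u} = ENNReal.ofReal (Real.pi * u) := by
    intro u hu
    rw [hball u hu, EuclideanSpace.volume_ball_fin_two, ← ENNReal.ofReal_pow (Real.sqrt_nonneg _),
      Real.sq_sqrt hu, mul_comm Real.pi, ENNReal.ofReal_mul hu]
  have hd : {x : Plane | s ≤ ‖x‖ ^ 2 ∧ ‖x‖ ^ 2 < t} =
      {x : Plane | ‖x‖ ^ 2 < t} \ {x : Plane | ‖x‖ ^ 2 < s} := by
    ext x
    simp [and_comm]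
  have hm : MeasurableSet {x : Plane | ‖x‖ ^ 2 < s} :=
    measurableSet_lt (by fun_prop) measurable_const
  have hsub : {x : Plane | ‖x‖ ^ 2 < s} ⊆ {x : Plane | ‖x‖ ^ 2 < t} := fun x hx => by
    simp only [mem_ofPred_eq] at hx ⊢
    exact hx.trans_le hst
  rw [hd, measure_sdiff hsub hm.nullMeasurableSet
    (by rw [hvol s hs]; simp), hvol s hs, hvol t (hs.trans hst), ← ENNReal.ofReal_sub]
  · ring_nf
  · positivity

/-- Two equidistant points share an annulus. The disc of squared radius `M` is covered by `M (k +
1)` annuli of area `π / (k + 1)`, each holding two points with probability `O(1 / (k + 1)²)`, so the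
union bound is `O(1 / (k + 1))`. -/
lemma IsHPPP.ae_norm_ne [IsProbabilityMeasure μ] (hX : IsHPPP μ lam X) (hlam : 0 ≤ lam) :
    ∀ᵐ ω ∂μ, ∀ n m, n ≠ m → ‖X n ω‖ ≠ ‖X m ω‖ := by
  simp only [ae_all_iff]
  intro n m hnm
  have hM : ∀ M : ℕ, μ {ω | ‖X n ω‖ = ‖X m ω‖ ∧ ‖X n ω‖ ^ 2 < M} = 0 := by
    intro M
    have hb : ∀ k : ℕ, μ {ω | ‖X n ω‖ = ‖X m ω‖ ∧ ‖X n ω‖ ^ 2 < M} ≤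
        ENNReal.ofReal (M * (lam * Real.pi) ^ 2 * (1 / (k + 1 : ℝ))) := by
      intro k
      have hk : (0 : ℝ) < k + 1 := by positivity
      -- Equal steps in the squared radius give annuli of equal area.
      set B : ℕ → Set Plane := fun j =>
        {x | (j : ℝ) / (k + 1) ≤ ‖x‖ ^ 2 ∧ ‖x‖ ^ 2 < ((j : ℝ) + 1) / (k + 1)} with hB
      have hBm : ∀ j, MeasurableSet (B j) := fun j =>
        (show Measurable fun x : Plane => ‖x‖ ^ 2 by fun_prop) measurableSet_Ico
      have hsub : {ω | ‖X n ω‖ = ‖X m ω‖ ∧ ‖X n ω‖ ^ 2 < M} ⊆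
          ⋃ j ∈ Finset.range (M * (k + 1)), {ω | 2 ≤ pointCount X (B j) ω} := by
        rintro ω ⟨h1, h2⟩
        have h3 : ∀ x : Plane, x ∈ B ⌊‖x‖ ^ 2 * (k + 1)⌋₊ := by
          intro x
          refine ⟨?_, ?_⟩
          · rw [div_le_iff₀ hk]
            exact Nat.floor_le (by positivity)
          · rw [lt_div_iff₀ hk]
            exact Nat.lt_floor_add_one _
        simp only [mem_iUnion, Finset.mem_range]
        refine ⟨⌊‖X n ω‖ ^ 2 * (k + 1)⌋₊, ?_, ?_⟩
        · rw [Nat.floor_lt (by positivity)]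
          push_cast
          exact mul_lt_mul_of_pos_right h2 hk
        · have hn := h3 (X n ω)
          have hm := h3 (X m ω)
          rw [← h1] at hm
          rw [mem_ofPred_eq, pointCount]
          refine le_trans ?_ (ENNReal.sum_le_tsum {n, m})
          rw [Finset.sum_pair hnm, indicator_of_mem hn, indicator_of_mem hm]
          norm_num
      have hvol : ∀ j : ℕ, volume (B j) = ENNReal.ofReal (Real.pi * (1 / (k + 1 : ℝ))) := by
        intro j
        rw [hB, volume_annulus (by positivity) (by gcongr; linarith)]
        congr 2
        ring
      calc _ ≤ μ (⋃ j ∈ Finset.range (M * (k + 1)), {ω | 2 ≤ pointCount X (B j) ω}) :=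
            measure_mono hsub
        _ ≤ ∑ j ∈ Finset.range (M * (k + 1)), μ {ω | 2 ≤ pointCount X (B j) ω} :=
            measure_biUnion_finset_le _ _
        _ ≤ ∑ j ∈ Finset.range (M * (k + 1)),
              ENNReal.ofReal ((lam * (Real.pi * (1 / (k + 1 : ℝ)))) ^ 2) :=
            Finset.sum_le_sum fun j _ =>
              measure_two_le_pointCount_le hX hlam (hBm j) (by positivity) (hvol j)
        _ = _ := by
            rw [Finset.sum_const, Finset.card_range, nsmul_eq_mul, ← ENNReal.ofReal_natCast,
              ← ENNReal.ofReal_mul (by positivity)]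
            congr 1
            push_cast
            field_simp
    have hl : Tendsto (fun k : ℕ => ENNReal.ofReal (M * (lam * Real.pi) ^ 2 * (1 / (k + 1 : ℝ))))
        atTop (𝓝 0) := by
      have := ENNReal.tendsto_ofReal
        (tendsto_one_div_add_atTop_nhds_zero_nat.const_mul (M * (lam * Real.pi) ^ 2))
      simpa using this
    exact le_antisymm (ge_of_tendsto' hl hb) zero_le
  have hae : ∀ᵐ ω ∂μ, ∀ M : ℕ, ¬(‖X n ω‖ = ‖X m ω‖ ∧ ‖X n ω‖ ^ 2 < M) := by
    rw [ae_all_iff]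
    intro M
    rw [ae_iff]
    simpa using hM M
  filter_upwards [hae] with ω hω h
  obtain ⟨M, hM⟩ := exists_nat_gt (‖X n ω‖ ^ 2)
  exact hω M ⟨h, hM⟩

end Poisson

lemma continuous_negLog : Continuous negLog :=
  EReal.continuous_toENNReal.comp (continuous_neg.comp ENNReal.continuous_log)

@[simp] lemma negLog_one : negLog 1 = 0 := by simpa using negLog_expNeg 0

/-! ### Independent marks -/

lemma measurable_const_add_tsum {Ω : Type*} {_ : MeasurableSpace Ω} (a : ℝ≥0∞)
    {g : ℕ → Ω → ℝ≥0∞} (hg : ∀ n, Measurable (g n)) : Measurable fun ω => a + ∑' n, g n ω :=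
  measurable_const.add (Measurable.tsum hg)

section Marks

variable {Ω : Type*} [MeasurableSpace Ω] {μ : Measure Ω} [IsProbabilityMeasure μ]

/-- Fubini for the product law: `u` can be frozen while the probability is taken over `v`. -/
lemma measure_mem_of_indepFun {U V : Type*} [MeasurableSpace U] [MeasurableSpace V]
    {u : Ω → U} {v : Ω → V} (hu : Measurable u) (hv : Measurable v) (huv : IndepFun u v μ)
    {T : Set (U × V)} (hT : MeasurableSet T) :
    μ {ω | (u ω, v ω) ∈ T} = ∫⁻ ω, μ {ω' | (u ω, v ω') ∈ T} ∂μ := by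
  have h1 : μ {ω | (u ω, v ω) ∈ T} = μ.map (fun ω => (u ω, v ω)) T :=
    (Measure.map_apply (hu.prodMk hv) hT).symm
  rw [h1, (indepFun_iff_map_prod_eq_prod_map_map hu.aemeasurable hv.aemeasurable).1 huv,
    Measure.prod_apply hT, lintegral_map (measurable_measure_prodMk_left hT) hu]
  refine lintegral_congr fun ω => ?_
  rw [Measure.map_apply hv (measurable_prodMk_left hT)]
  rfl

/-- The probability that `n` is marked and no point with property `Q` is. -/
lemma measure_marked_and_forall {c : ℕ → Ω → Bool} (hc : ∀ n, Measurable (c n))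
    (hind : iIndepFun c μ) {p : ℝ} (hp0 : 0 ≤ p)
    (hp : ∀ n, μ {ω | c n ω = true} = ENNReal.ofReal p) (n : ℕ) (Q : ℕ → Prop) [DecidablePred Q]
    (hQ : ¬ Q n) :
    μ {ω | c n ω = true ∧ ∀ m, c m ω = true → ¬ Q m} =
      ENNReal.ofReal p *
        expNeg (∑' m, negLog (if Q m then ENNReal.ofReal (1 - p) else 1)) := by
  -- The event prescribes each mark separately: marked at `n`, unmarked where `Q` holds, free
  -- elsewhere.
  set s : ℕ → Set Bool := fun m => if m = n then {true} else if Q m then {false} else univ with hs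
  have htrue : ∀ m, μ (c m ⁻¹' {true}) = ENNReal.ofReal p := hp
  have hfalse : ∀ m, μ (c m ⁻¹' {false}) = ENNReal.ofReal (1 - p) := by
    intro m
    have h1 : c m ⁻¹' {false} = (c m ⁻¹' {true})ᶜ := by ext ω; simp
    rw [h1, prob_compl_eq_one_sub (hc m (measurableSet_singleton _)), htrue,
      ENNReal.ofReal_sub _ hp0, ENNReal.ofReal_one]
  set w : ℕ → ℝ≥0∞ := fun m => if Q m then ENNReal.ofReal (1 - p) else 1 with hw
  have hw1 : ∀ m, w m ≤ 1 := by
    intro m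
    by_cases h : Q m <;> simp [hw, h, hp0]
  have hμs : ∀ m, μ (c m ⁻¹' s m) = (if m = n then ENNReal.ofReal p else 1) * w m := by
    intro m
    by_cases hm : m = n
    · subst hm
      simp [hs, hw, hQ, htrue]
    · by_cases h : Q m <;> simp [hs, hw, hm, h, hfalse, -Bool.univ_eq]
  have hset : {ω | c n ω = true ∧ ∀ m, c m ω = true → ¬ Q m} = ⋂ m, c m ⁻¹' s m := by
    ext ω
    simp only [mem_ofPred_eq, mem_iInter, mem_preimage, hs]
    constructor
    · rintro ⟨h1, h2⟩ m
      by_cases hm : m = n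
      · subst hm; simpa using h1
      · by_cases h : Q m
        · simpa [hm, h] using fun hc' => h2 m hc' h
        · simp [hm, h]
    · intro h
      have h1 : c n ω = true := by simpa using h n
      refine ⟨h1, fun m hm hQm => ?_⟩
      have hmn : m ≠ n := fun e => hQ (e ▸ hQm)
      have := h m
      simp [hmn, hQm, hm] at this
  have hms : ∀ m, MeasurableSet (c m ⁻¹' s m) := fun m => hc m (MeasurableSet.of_discrete)
  -- The factor `p` of the index `n` appears only once the finite intersection has reached `n`.
  have hfin : ∀ M, n < M → μ (⋂ m ∈ Finset.range M, c m ⁻¹' s m) =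
      ENNReal.ofReal p * ∏ m ∈ Finset.range M, expNeg (negLog (w m)) := by
    intro M hM
    rw [hind.measure_inter_preimage_eq_mul _ fun m _ => MeasurableSet.of_discrete]
    simp_rw [hμs, Finset.prod_mul_distrib, expNeg_negLog (hw1 _)]
    rw [Finset.prod_ite_eq' (Finset.range M) n, if_pos (Finset.mem_range.2 hM)]
  have hL : Tendsto (fun M => μ (⋂ m ∈ Finset.range M, c m ⁻¹' s m)) atTop
      (𝓝 (μ (⋂ m, c m ⁻¹' s m))) := by
    have h1 : ⋂ m, c m ⁻¹' s m = ⋂ M, ⋂ m ∈ Finset.range M, c m ⁻¹' s m := by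
      ext ω
      simp only [mem_iInter, Finset.mem_range]
      exact ⟨fun h M m _ => h m, fun h m => h (m + 1) m (Nat.lt_succ_self m)⟩
    rw [h1]
    refine tendsto_measure_iInter_atTop
      (fun M => (Finset.measurableSet_biInter _ fun m _ => hms m).nullMeasurableSet)
      (fun M M' h => ?_) ⟨0, measure_ne_top _ _⟩
    exact biInter_subset_biInter_left fun m hm =>
      Finset.mem_range.2 ((Finset.mem_range.1 hm).trans_le h)
  rw [hset]
  refine tendsto_nhds_unique hL ((ENNReal.Tendsto.const_mul
    (tendsto_prod_expNeg fun m => negLog (w m)) (.inr (by simp))).congr' ?_)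
  filter_upwards [eventually_gt_atTop n] with M hM
  exact (hfin M hM).symm

/-- Independence factors the finite products, and bounded convergence passes to the infinite one,
with no convergence assumption on the sum. -/
lemma lintegral_expNeg_tsum_of_iIndepFun {Y : ℕ → Ω → ℝ} (hY : ∀ n, Measurable (Y n))
    (hind : iIndepFun Y μ) (hlaw : ∀ n, HasLaw (Y n) (expMeasure 1) μ) {b : ℕ → ℝ}
    (hb : ∀ n, 0 ≤ b n) :
    ∫⁻ ω, expNeg (∑' m, ENNReal.ofReal (b m * Y m ω)) ∂μ =
      expNeg (∑' m, negLog (ENNReal.ofReal (1 / (1 + b m)))) := by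
  have hg : ∀ m, Measurable fun y : ℝ => expNeg (ENNReal.ofReal (b m * y)) := fun m => by fun_prop
  have hle : ∀ m, ENNReal.ofReal (1 / (1 + b m)) ≤ 1 := fun m => by
    have := hb m
    rw [ENNReal.ofReal_le_one, div_le_one (by linarith)]
    linarith
  have h1 : ∀ M, ∫⁻ ω, ∏ m ∈ Finset.range M, expNeg (ENNReal.ofReal (b m * Y m ω)) ∂μ =
      ∏ m ∈ Finset.range M, expNeg (negLog (ENNReal.ofReal (1 / (1 + b m)))) := by
    intro M
    rw [lintegral_prod_eq_prod_lintegral_of_indepFun (Finset.range M)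
      (fun m ω => expNeg (ENNReal.ofReal (b m * Y m ω))) (hind.comp _ hg)
      fun m => (hg m).comp (hY m)]
    refine Finset.prod_congr rfl fun m _ => ?_
    rw [expNeg_negLog (hle m), ← lintegral_expNeg_expMeasure (hb m)]
    exact (hlaw m).lintegral_comp (hg m).aemeasurable
  have hL : Tendsto (fun M => ∫⁻ ω, ∏ m ∈ Finset.range M,
      expNeg (ENNReal.ofReal (b m * Y m ω)) ∂μ) atTop
      (𝓝 (∫⁻ ω, expNeg (∑' m, ENNReal.ofReal (b m * Y m ω)) ∂μ)) := by
    refine tendsto_lintegral_of_dominated_convergence (fun _ => 1) (fun M => ?_)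
      (fun M => ae_of_all _ fun ω => Finset.prod_le_one' fun m _ => expNeg_le_one _) (by simp)
      (ae_of_all _ fun ω => tendsto_prod_expNeg _)
    exact Finset.measurable_prod _ fun m _ => (hg m).comp (hY m)
  simp_rw [h1] at hL
  exact tendsto_nhds_unique hL (tendsto_prod_expNeg _)

/-- An exponential variable exceeds `a` plus a nonnegative combination of the others. -/
lemma measure_add_tsum_lt {Y : ℕ → Ω → ℝ} (hY : ∀ n, Measurable (Y n))
    (hind : iIndepFun Y μ) (hlaw : ∀ n, HasLaw (Y n) (expMeasure 1) μ) {b : ℕ → ℝ}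
    (hb : ∀ n, 0 ≤ b n) (a : ℝ≥0∞) {n : ℕ} (hbn : b n = 0) :
    μ {ω | a + ∑' m, ENNReal.ofReal (b m * Y m ω) < ENNReal.ofReal (Y n ω)} =
      expNeg (a + ∑' m, negLog (ENNReal.ofReal (1 / (1 + b m)))) := by
  set Z : Ω → ℝ≥0∞ := fun ω => a + ∑' m, ENNReal.ofReal (b m * Y m ω) with hZ
  have hZm : Measurable Z := by
    refine measurable_const_add_tsum _ fun m => ?_
    have := hY m
    fun_prop
  -- As `b n = 0`, the variable `Z` is measurable with respect to the `Y m` with `m ≠ n`.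
  have hZind : IndepFun Z (Y n) μ := by
    have h1 : Indep (⨆ i ∈ ({n}ᶜ : Set ℕ), MeasurableSpace.comap (Y i) inferInstance)
        (⨆ i ∈ ({n} : Set ℕ), MeasurableSpace.comap (Y i) inferInstance) μ :=
      indep_iSup_of_disjoint (fun i => (hY i).comap_le) hind disjoint_compl_left
    refine indep_of_indep_of_le_left (indep_of_indep_of_le_right h1 ?_) ?_
    · exact le_iSup₂_of_le n rfl le_rfl
    · rw [← measurable_iff_comap_le]
      refine measurable_const_add_tsum _ fun m => ?_
      by_cases hm : m = n
      · simp [hm, hbn]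
      · have h2 : Measurable[⨆ i ∈ ({n}ᶜ : Set ℕ), MeasurableSpace.comap (Y i) inferInstance]
            (Y m) :=
          measurable_iff_comap_le.2 (le_iSup₂_of_le m hm le_rfl)
        exact ENNReal.measurable_ofReal.comp (h2.const_mul _)
  have hT : MeasurableSet {q : ℝ≥0∞ × ℝ | q.1 < ENNReal.ofReal q.2} :=
    measurableSet_lt (by fun_prop) (by fun_prop)
  have h2 := measure_mem_of_indepFun hZm (hY n) hZind hT
  have h3 : ∀ ω, μ {ω' | (Z ω, Y n ω') ∈ {q : ℝ≥0∞ × ℝ | q.1 < ENNReal.ofReal q.2}} =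
      expNeg (Z ω) := by
    intro ω
    rw [← expMeasure_lt_ofReal]
    exact (hlaw n).measure_eq (p := fun y => Z ω < ENNReal.ofReal y)
      (measurableSet_lt measurable_const (by fun_prop))
  simp_rw [h3] at h2
  refine h2.trans ?_
  simp_rw [hZ, expNeg_add]
  rw [lintegral_const_mul, lintegral_expNeg_tsum_of_iIndepFun hY hind hlaw hb]
  refine measurable_expNeg.comp (Measurable.tsum fun m => ?_)
  have := hY m
  fun_prop

end Marks

/-! ### Reduction of the coverage probability to the Poisson point process -/

/-- Minus the logarithm of the probability that a station at `y` is not a caching one nearer than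
`r`, times the conditional Laplace transform of its interference. -/
def radialWeight (p τ r : ℝ) (y : Plane) : ℝ≥0∞ :=
  negLog (if ‖y‖ < r then ENNReal.ofReal (1 - p) else 1) +
    negLog (ENNReal.ofReal (1 / (1 + τ * r ^ 4 * (‖y‖ ^ 4)⁻¹)))

lemma measurable_radialWeight (p τ : ℝ) : Measurable (Function.uncurry (radialWeight p τ)) := by
  have h1 : Measurable fun q : ℝ × Plane => if ‖q.2‖ < q.1 then ENNReal.ofReal (1 - p) else 1 :=
    Measurable.ite (measurableSet_lt (by fun_prop) (by fun_prop)) measurable_const measurable_const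
  have h2 : Measurable fun q : ℝ × Plane =>
      ENNReal.ofReal (1 / (1 + τ * q.1 ^ 4 * (‖q.2‖ ^ 4)⁻¹)) := by fun_prop
  exact (measurable_negLog.comp h1).add (measurable_negLog.comp h2)

/-- The strict inequality `‖y‖ < r` makes the jump at `r = ‖y‖` left-continuous, as the Mecke
formula needs. -/
lemma continuousWithinAt_radialWeight (p : ℝ) {τ : ℝ} (hτ : 0 ≤ τ) (r : ℝ) (y : Plane) :
    ContinuousWithinAt (fun s => radialWeight p τ s y) (Iic r) r := by
  refine ContinuousWithinAt.add ?_ ?_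
  · by_cases h : ‖y‖ < r
    · refine (continuousWithinAt_const (b := negLog (ENNReal.ofReal (1 - p)))).congr_of_eventuallyEq
        ?_ (by rw [if_pos h])
      filter_upwards [mem_nhdsWithin_of_mem_nhds (Ioi_mem_nhds h)] with s hs
      rw [if_pos (mem_Ioi.1 hs)]
    · refine (continuousWithinAt_const (b := negLog 1)).congr (fun s hs => ?_) (by rw [if_neg h])
      rw [if_neg fun hs' => h (lt_of_lt_of_le hs' hs)]
  · refine Continuous.continuousWithinAt ?_
    refine continuous_negLog.comp (ENNReal.continuous_ofReal.comp ?_)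
    refine Continuous.div continuous_const (by fun_prop) fun s => ?_
    have : 0 ≤ τ * s ^ 4 * (‖y‖ ^ 4)⁻¹ := by positivity
    linarith

lemma monotoneOn_radialWeight {p τ : ℝ} (hp : 0 ≤ p) (hτ : 0 ≤ τ) (y : Plane) :
    MonotoneOn (fun s => radialWeight p τ s y) (Ici 0) := by
  intro s hs t ht hst
  rw [mem_Ici] at hs
  refine add_le_add (negLog_antitone ?_) (negLog_antitone ?_)
  · by_cases h : ‖y‖ < s
    · rw [if_pos h, if_pos (h.trans_le hst)]
    · rw [if_neg h]
      split_ifs <;> simp [hp]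
  · refine ENNReal.ofReal_le_ofReal ?_
    gcongr

/-- The serving station's own term in the sum over all points. It does not depend on the location,
so it can be cancelled at the end. -/
lemma radialWeight_self (p τ : ℝ) {x : Plane} (hx : x ≠ 0) :
    radialWeight p τ ‖x‖ x = negLog (ENNReal.ofReal (1 / (1 + τ))) := by
  have h : ‖x‖ ^ 4 ≠ 0 := pow_ne_zero _ (norm_ne_zero_iff.2 hx)
  rw [radialWeight, if_neg (lt_irrefl _), negLog_one, zero_add, mul_assoc, mul_inv_cancel₀ h,
    mul_one]

lemma pathLoss_four (C : ℝ) {r : ℝ} (hr : 0 ≤ r) : pathLoss C 4 r = C * (r ^ 4)⁻¹ := by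
  rw [pathLoss, Real.rpow_neg hr]
  norm_cast

section Model

variable {Ω : Type*}

/-- Clear the denominator and divide by `K`, the mean power received from the serving station. The
caching and non-caching interference merge into one sum over `m ≠ n`. -/
lemma ofReal_lt_sinrFrom_iff {P C σ τ : ℝ} {N : ℕ} (hP : 0 < P) (hC : 0 < C) (hN : 0 < N)
    (hσ : σ ≠ 0) (hτ : 0 < τ) (X : ℕ → Ω → Plane) (h : ℕ → Ω → ℂ) (cached : ℕ → Ω → Bool)
    {n : ℕ} {ω : Ω} (hn : cached n ω = true) (hX : X n ω ≠ 0) :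
    ENNReal.ofReal τ < sinrFrom P C 4 σ N X h cached n ω ↔
      ENNReal.ofReal (coeffB P C σ N τ * ‖X n ω‖ ^ 4) +
        ∑' m, ENNReal.ofReal ((if m = n then 0 else τ * ‖X n ω‖ ^ 4 * (‖X m ω‖ ^ 4)⁻¹) *
          ‖h m ω‖ ^ 2) < ENNReal.ofReal (‖h n ω‖ ^ 2) := by
  have hr : 0 < ‖X n ω‖ := norm_pos_iff.2 hX
  have hN' : (0 : ℝ) < N := by exact_mod_cast hN
  set K : ℝ := P * C * N * (‖X n ω‖ ^ 4)⁻¹ with hK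
  have hK0 : 0 < K := by positivity
  have hσ2 : 0 < σ ^ 2 := by positivity
  have hI : interferenceCaching P C 4 N X h cached n ω + interferenceNonCaching P C 4 N X h cached ω
      = ∑' m, ENNReal.ofReal ((if m = n then 0 else P * C * N * (‖X m ω‖ ^ 4)⁻¹) *
          ‖h m ω‖ ^ 2) := by
    rw [interferenceCaching, interferenceNonCaching, ← ENNReal.tsum_add]
    refine tsum_congr fun m => ?_
    have hpow : interferingPower P C 4 N X h m ω =
        ENNReal.ofReal (P * C * N * (‖X m ω‖ ^ 4)⁻¹ * ‖h m ω‖ ^ 2) := by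
      rw [interferingPower, pathLoss_four C (norm_nonneg _), arrayGain]
      ring_nf
    by_cases hmn : m = n
    · subst hmn; simp [hn]
    · cases hc : cached m ω <;> simp [hmn, hpow]
  have hnum : ENNReal.ofReal (P * pathLoss C 4 ‖X n ω‖ * G₀ * N * ‖h n ω‖ ^ 2) =
      ENNReal.ofReal K * ENNReal.ofReal (‖h n ω‖ ^ 2) := by
    rw [← ENNReal.ofReal_mul hK0.le, pathLoss_four C (norm_nonneg _), G₀, hK]
    ring_nf
  have hden : ENNReal.ofReal τ * (ENNReal.ofReal (σ ^ 2) +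
      ∑' m, ENNReal.ofReal ((if m = n then 0 else P * C * N * (‖X m ω‖ ^ 4)⁻¹) * ‖h m ω‖ ^ 2)) =
      ENNReal.ofReal K * (ENNReal.ofReal (coeffB P C σ N τ * ‖X n ω‖ ^ 4) +
        ∑' m, ENNReal.ofReal ((if m = n then 0 else τ * ‖X n ω‖ ^ 4 * (‖X m ω‖ ^ 4)⁻¹) *
          ‖h m ω‖ ^ 2)) := by
    rw [mul_add, mul_add, ← ENNReal.tsum_mul_left, ← ENNReal.tsum_mul_left,
      ← ENNReal.ofReal_mul hτ.le, ← ENNReal.ofReal_mul hK0.le]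
    congr 1
    · rw [hK, coeffB, G₀]
      congr 1
      field_simp
    · refine tsum_congr fun m => ?_
      rw [← ENNReal.ofReal_mul hτ.le, ← ENNReal.ofReal_mul hK0.le, hK]
      congr 1
      split_ifs
      · simp
      · field_simp
  rw [sinrFrom, add_assoc, hI, hnum, ENNReal.lt_div_iff_mul_lt, hden,
    ENNReal.mul_lt_mul_iff_right (by simpa using hK0) (by simp)]
  · exact .inl (by simp [hσ])
  · right
    simpa using hτ

variable [MeasurableSpace Ω] {μ : Measure Ω} [IsProbabilityMeasure μ] {lam p : ℝ}
  {X : ℕ → Ω → Plane} {h : ℕ → Ω → ℂ} {cached : ℕ → Ω → Bool}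

/-- In terms of locations `q.1` and marks `q.2`: station `n` serves, and the SINR exceeds `τ`. -/
def servedSet (B τ : ℝ) (n : ℕ) : Set ((ℕ → Plane) × (ℕ → ℂ × Bool)) :=
  {q | ((q.2 n).2 = true ∧ ∀ m, (q.2 m).2 = true → ¬ ‖q.1 m‖ < ‖q.1 n‖) ∧
    ENNReal.ofReal (B * ‖q.1 n‖ ^ 4) +
      ∑' m, ENNReal.ofReal ((if m = n then 0 else τ * ‖q.1 n‖ ^ 4 * (‖q.1 m‖ ^ 4)⁻¹) *
        ‖(q.2 m).1‖ ^ 2) < ENNReal.ofReal (‖(q.2 n).1‖ ^ 2)}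

lemma measurableSet_servedSet (B τ : ℝ) (n : ℕ) : MeasurableSet (servedSet B τ n) := by
  have hloc : ∀ m, Measurable fun q : (ℕ → Plane) × (ℕ → ℂ × Bool) => ‖q.1 m‖ := fun m => by
    fun_prop
  have hmark : ∀ m, Measurable fun q : (ℕ → Plane) × (ℕ → ℂ × Bool) => q.2 m := fun m => by
    fun_prop
  have hc : ∀ m, MeasurableSet {q : (ℕ → Plane) × (ℕ → ℂ × Bool) | (q.2 m).2 = true} := fun m =>
    (hmark m).snd (measurableSet_singleton true)
  have hY : ∀ m, Measurable fun q : (ℕ → Plane) × (ℕ → ℂ × Bool) => ‖(q.2 m).1‖ ^ 2 := fun m =>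
    (hmark m).fst.norm.pow_const 2
  refine MeasurableSet.inter (MeasurableSet.inter (hc n) ?_) ?_
  · change MeasurableSet {q : (ℕ → Plane) × (ℕ → ℂ × Bool) |
      ∀ m, (q.2 m).2 = true → ¬ ‖q.1 m‖ < ‖q.1 n‖}
    simp only [imp_iff_not_or, not_lt, ofPred_forall]
    exact MeasurableSet.iInter fun m => (hc m).compl.union (measurableSet_le (hloc n) (hloc m))
  · change MeasurableSet {q : (ℕ → Plane) × (ℕ → ℂ × Bool) | ENNReal.ofReal (B * ‖q.1 n‖ ^ 4) +
      ∑' m, ENNReal.ofReal ((if m = n then 0 else τ * ‖q.1 n‖ ^ 4 * (‖q.1 m‖ ^ 4)⁻¹) *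
        ‖(q.2 m).1‖ ^ 2) < ENNReal.ofReal (‖(q.2 n).1‖ ^ 2)}
    refine measurableSet_lt (Measurable.add (((hloc n).pow_const 4).const_mul B).ennreal_ofReal
      (Measurable.tsum fun m => Measurable.ennreal_ofReal (Measurable.mul ?_ (hY m))))
      (hY n).ennreal_ofReal
    split_ifs
    · exact measurable_const
    · exact (((hloc n).pow_const 4).const_mul τ).mul ((hloc m).pow_const 4).inv

/-- Freeze the locations; caching and fading then contribute independent factors. The extra factor
`1 / (1 + τ)` on the left completes the sum over `m ≠ n` to a sum over all points, the form required
by the Mecke formula. -/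
lemma IsMacroTier.measure_servedSet (hmodel : IsMacroTier μ lam p X h cached) (hlam : 0 ≤ lam)
    (hp : 0 ≤ p) {B τ : ℝ} (hτ : 0 ≤ τ) (n : ℕ) :
    μ {ω | ((fun n => X n ω, fun n => (h n ω, cached n ω)) :
        (ℕ → Plane) × (ℕ → ℂ × Bool)) ∈ servedSet B τ n} * ENNReal.ofReal (1 / (1 + τ)) =
      ENNReal.ofReal p * ∫⁻ ω, expNeg (ENNReal.ofReal (B * ‖X n ω‖ ^ 4) +
        ∑' m, radialWeight p τ ‖X n ω‖ (X m ω)) ∂μ := by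
  have hXm := hmodel.hppp.measurable
  have hhm := hmodel.measurable_fading
  have hcm := hmodel.measurable_cached
  have hYind : iIndepFun (fun n ω => ‖h n ω‖ ^ 2) μ :=
    hmodel.indep_fading.comp (fun _ z => ‖z‖ ^ 2) fun _ => by fun_prop
  have hYm : ∀ n, Measurable fun ω => ‖h n ω‖ ^ 2 := fun n => (hhm n).norm.pow_const 2
  have hτ1 : ENNReal.ofReal (1 / (1 + τ)) ≤ 1 := by
    rw [ENNReal.ofReal_le_one, div_le_one (by linarith)]
    linarith
  rw [measure_mem_of_indepFun (measurable_pi_lambda _ hXm)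
    (measurable_pi_lambda _ fun n => (hhm n).prodMk (hcm n)) hmodel.indep_location_marks
    (measurableSet_servedSet B τ n), ← lintegral_mul_const' _ _ (by simp),
    ← lintegral_const_mul' _ _ (by simp)]
  refine lintegral_congr_ae ?_
  filter_upwards [hmodel.hppp.ae_ne_zero hlam] with ω hω
  set b : ℕ → ℝ := fun m => if m = n then 0 else τ * ‖X n ω‖ ^ 4 * (‖X m ω‖ ^ 4)⁻¹ with hb
  have hb0 : ∀ m, 0 ≤ b m := by
    intro m
    simp only [hb]
    split_ifs
    · exact le_rfl
    · positivity
  have hsplit : {ω' | ((fun n => X n ω, fun n => (h n ω', cached n ω')) :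
        (ℕ → Plane) × (ℕ → ℂ × Bool)) ∈ servedSet B τ n} =
      {ω' | ENNReal.ofReal (B * ‖X n ω‖ ^ 4) + ∑' m, ENNReal.ofReal (b m * ‖h m ω'‖ ^ 2) <
        ENNReal.ofReal (‖h n ω'‖ ^ 2)} ∩
      {ω' | cached n ω' = true ∧ ∀ m, cached m ω' = true → ¬ ‖X m ω‖ < ‖X n ω‖} := by
    ext ω'
    exact and_comm
  have hprod : μ ({ω' | ENNReal.ofReal (B * ‖X n ω‖ ^ 4) +
        ∑' m, ENNReal.ofReal (b m * ‖h m ω'‖ ^ 2) < ENNReal.ofReal (‖h n ω'‖ ^ 2)} ∩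
      {ω' | cached n ω' = true ∧ ∀ m, cached m ω' = true → ¬ ‖X m ω‖ < ‖X n ω‖}) =
      μ {ω' | ENNReal.ofReal (B * ‖X n ω‖ ^ 4) +
        ∑' m, ENNReal.ofReal (b m * ‖h m ω'‖ ^ 2) < ENNReal.ofReal (‖h n ω'‖ ^ 2)} *
      μ {ω' | cached n ω' = true ∧ ∀ m, cached m ω' = true → ¬ ‖X m ω‖ < ‖X n ω‖} := by
    refine hmodel.indep_fading_cached.measure_inter_preimage_eq_mul
      {z : ℕ → ℂ | ENNReal.ofReal (B * ‖X n ω‖ ^ 4) +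
        ∑' m, ENNReal.ofReal (b m * ‖z m‖ ^ 2) < ENNReal.ofReal (‖z n‖ ^ 2)}
      {c : ℕ → Bool | c n = true ∧ ∀ m, c m = true → ¬ ‖X m ω‖ < ‖X n ω‖} ?_ ?_
    · exact measurableSet_lt (measurable_const_add_tsum _ fun m => by fun_prop) (by fun_prop)
    · have hc : ∀ m, MeasurableSet {c : ℕ → Bool | c m = true} := fun m =>
        (show Measurable fun c : ℕ → Bool => c m from measurable_pi_apply m)
          (measurableSet_singleton true)
      refine MeasurableSet.inter (hc n) ?_
      change MeasurableSet {c : ℕ → Bool | ∀ m, c m = true → ¬ ‖X m ω‖ < ‖X n ω‖}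
      simp only [imp_iff_not_or, ofPred_forall]
      exact MeasurableSet.iInter fun m => (hc m).compl.union (MeasurableSet.const _)
  rw [hsplit, hprod, measure_add_tsum_lt hYm hYind hmodel.rayleigh hb0 _ (by simp [hb]),
    measure_marked_and_forall hcm hmodel.indep_cached hp hmodel.prob_cached n
      (fun m => ‖X m ω‖ < ‖X n ω‖) (lt_irrefl _)]
  have hsum : ∑' m, radialWeight p τ ‖X n ω‖ (X m ω) =
      ∑' m, negLog (if ‖X m ω‖ < ‖X n ω‖ then ENNReal.ofReal (1 - p) else 1) +
        (∑' m, negLog (ENNReal.ofReal (1 / (1 + b m))) +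
          negLog (ENNReal.ofReal (1 / (1 + τ)))) := by
    -- The spare logarithm is written as a series supported at `m = n`, where `b` vanishes.
    rw [← tsum_ite_eq n (fun _ => negLog (ENNReal.ofReal (1 / (1 + τ)))), ← ENNReal.tsum_add,
      ← ENNReal.tsum_add]
    refine tsum_congr fun m => ?_
    rw [radialWeight]
    by_cases hm : m = n
    · subst hm
      have h4 : ‖X m ω‖ ^ 4 ≠ 0 := pow_ne_zero _ (norm_ne_zero_iff.2 (hω m))
      simp [hb, mul_assoc, mul_inv_cancel₀ h4]
    · simp [hb, hm]
  rw [hsum]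
  simp only [expNeg_add]
  rw [expNeg_negLog hτ1]
  ring

end Model

/-- Without ties the nearest caching station is unique, so the least-index rule plays no role. -/
lemma lt_sinr_iff {Ω : Type*} {X : ℕ → Ω → Plane} {h : ℕ → Ω → ℂ} {cached : ℕ → Ω → Bool}
    {P C σ τ : ℝ} {N : ℕ} {ω : Ω}
    (hties : ∀ n m, n ≠ m → ‖X n ω‖ ≠ ‖X m ω‖) :
    ENNReal.ofReal τ < sinr P C 4 σ N X h cached ω ↔
      ∃ n, IsNearestCaching X cached ω n ∧
        ENNReal.ofReal τ < sinrFrom P C 4 σ N X h cached n ω := by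
  classical
  have huniq : ∀ n m, IsNearestCaching X cached ω n → IsNearestCaching X cached ω m → n = m := by
    intro n m hn hm
    by_contra hne
    exact hties n m hne (le_antisymm (hn.2 m hm.1) (hm.2 n hn.1))
  unfold sinr
  constructor
  · intro hlt
    split_ifs at hlt with hex
    · exact ⟨_, Nat.find_spec hex, hlt⟩
    · simp at hlt
  · rintro ⟨n, hn, hlt⟩
    have hex : ∃ n, IsNearestCaching X cached ω n := ⟨n, hn⟩
    rw [dif_pos hex, huniq _ n (Nat.find_spec hex) hn]
    exact hlt

section Model

variable {Ω : Type*} [MeasurableSpace Ω] {μ : Measure Ω} [IsProbabilityMeasure μ] {lam p : ℝ}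
  {X : ℕ → Ω → Plane} {h : ℕ → Ω → ℂ} {cached : ℕ → Ω → Bool}

/-- The coverage probability as an integral over the location of the serving station. -/
theorem IsMacroTier.measure_lt_sinr (hmodel : IsMacroTier μ lam p X h cached) {P C σ τ : ℝ}
    {N : ℕ} (hlam : 0 ≤ lam) (hp : 0 ≤ p) (hP : 0 < P) (hC : 0 < C) (hN : 0 < N) (hσ : σ ≠ 0)
    (hτ : 0 < τ) :
    μ {ω | ENNReal.ofReal τ < sinr P C 4 σ N X h cached ω} =
      ENNReal.ofReal p * (ENNReal.ofReal lam * ∫⁻ x : Plane,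
        expNeg (ENNReal.ofReal (coeffB P C σ N τ * ‖x‖ ^ 4) +
          ENNReal.ofReal lam * ∫⁻ y, (1 - expNeg (radialWeight p τ ‖x‖ y)))) := by
  set B := coeffB P C σ N τ with hB
  set v := ENNReal.ofReal (1 / (1 + τ)) with hv
  have hv0 : v ≠ 0 := by
    rw [hv, ENNReal.ofReal_ne_zero_iff]
    positivity
  have hvt : v ≠ ∞ := ENNReal.ofReal_ne_top
  have hv1 : v ≤ 1 := by
    rw [hv, ENNReal.ofReal_le_one, div_le_one (by linarith)]
    linarith
  set E : ℕ → Set Ω := fun n => {ω | ((fun n => X n ω, fun n => (h n ω, cached n ω)) :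
    (ℕ → Plane) × (ℕ → ℂ × Bool)) ∈ servedSet B τ n} with hE
  have hEm : ∀ n, MeasurableSet (E n) := fun n =>
    ((measurable_pi_lambda _ hmodel.hppp.measurable).prodMk (measurable_pi_lambda _ fun n =>
      (hmodel.measurable_fading n).prodMk (hmodel.measurable_cached n)))
        (measurableSet_servedSet B τ n)
  have hEiff : ∀ᵐ ω ∂μ, ∀ n, ω ∈ E n ↔ IsNearestCaching X cached ω n ∧
      ENNReal.ofReal τ < sinrFrom P C 4 σ N X h cached n ω := by
    filter_upwards [hmodel.hppp.ae_ne_zero hlam] with ω hω n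
    constructor
    · rintro ⟨⟨h1, h2⟩, h3⟩
      exact ⟨⟨h1, fun m hm => not_lt.1 (h2 m hm)⟩,
        (ofReal_lt_sinrFrom_iff hP hC hN hσ hτ X h cached h1 (hω n)).2 h3⟩
    · rintro ⟨⟨h1, h2⟩, h3⟩
      exact ⟨⟨h1, fun m hm => not_lt.2 (h2 m hm)⟩,
        (ofReal_lt_sinrFrom_iff hP hC hN hσ hτ X h cached h1 (hω n)).1 h3⟩
  have hunion : {ω | ENNReal.ofReal τ < sinr P C 4 σ N X h cached ω} =ᵐ[μ] ⋃ n, E n := by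
    filter_upwards [hEiff, hmodel.hppp.ae_norm_ne hlam] with ω h1 h2
    refine propext ?_
    change ENNReal.ofReal τ < sinr P C 4 σ N X h cached ω ↔ ω ∈ ⋃ n, E n
    rw [lt_sinr_iff h2, mem_iUnion]
    exact exists_congr fun n => (h1 n).symm
  have hdisj : Pairwise (Function.onFun (AEDisjoint μ) E) := by
    intro n m hnm
    rw [Function.onFun, AEDisjoint, measure_eq_zero_iff_ae_notMem]
    filter_upwards [hEiff, hmodel.hppp.ae_norm_ne hlam] with ω h1 h2 h3
    have hn := ((h1 n).1 h3.1).1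
    have hm := ((h1 m).1 h3.2).1
    exact h2 n m hnm (le_antisymm (hn.2 m hm.1) (hm.2 n hn.1))
  have hmeas : ∀ n, Measurable fun ω => expNeg (ENNReal.ofReal (B * ‖X n ω‖ ^ 4) +
      ∑' m, radialWeight p τ ‖X n ω‖ (X m ω)) := by
    intro n
    have := measurable_indicator_expNeg hmodel.hppp.measurable
      (a := fun r => ENNReal.ofReal (B * r ^ 4)) (by fun_prop) (measurable_radialWeight p τ)
      MeasurableSet.univ measurable_norm n
    simpa using this
  have hmecke := hmodel.hppp.mecke_radial_univ hlam (a := fun r => ENNReal.ofReal (B * r ^ 4))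
    (F := radialWeight p τ) (by fun_prop) (measurable_radialWeight p τ)
    (fun r => Continuous.continuousWithinAt (ENNReal.continuous_ofReal.comp (by fun_prop)))
    (fun r y => continuousWithinAt_radialWeight p hτ.le r y)
    (fun y => monotoneOn_radialWeight hp hτ.le y)
  have hself : ∫⁻ x : Plane, expNeg (ENNReal.ofReal (B * ‖x‖ ^ 4) + radialWeight p τ ‖x‖ x +
        ENNReal.ofReal lam * ∫⁻ y, (1 - expNeg (radialWeight p τ ‖x‖ y))) =
      (∫⁻ x : Plane, expNeg (ENNReal.ofReal (B * ‖x‖ ^ 4) +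
        ENNReal.ofReal lam * ∫⁻ y, (1 - expNeg (radialWeight p τ ‖x‖ y)))) * v := by
    rw [← lintegral_mul_const' _ _ hvt]
    refine lintegral_congr_ae ?_
    have hne : ∀ᵐ x : Plane, x ≠ 0 := by simp [ae_iff]
    filter_upwards [hne] with x hx
    rw [radialWeight_self p τ hx]
    simp only [expNeg_add]
    rw [expNeg_negLog hv1]
    ring
  -- Both sides are multiplied by `v = 1 / (1 + τ)`, which is neither `0` nor `∞`: on the left it
  -- completes the sums, on the right it is the serving station's own term in the Mecke formula.
  rw [measure_congr hunion, measure_iUnion₀ hdisj fun n => (hEm n).nullMeasurableSet,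
    ← ENNReal.mul_left_inj hv0 hvt, ← ENNReal.tsum_mul_right]
  simp_rw [hE, hv, fun n => hmodel.measure_servedSet hlam hp hτ.le (B := B) n]
  rw [ENNReal.tsum_mul_left, ← lintegral_tsum fun n => (hmeas n).aemeasurable, hmecke, hself]
  ring

end Model

/-! ### Radial integrals -/

lemma lintegral_ofReal_norm {g : ℝ → ℝ} (hg : ∀ s, 0 ≤ s → 0 ≤ g s)
    (hint : IntegrableOn (fun s => s * g s) (Ioi 0)) :
    ∫⁻ y : Plane, ENNReal.ofReal (g ‖y‖) =
      ENNReal.ofReal (2 * Real.pi * ∫ s in Ioi 0, s * g s) := by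
  have h1 : Integrable (fun y : Plane => g ‖y‖) := by
    rw [integrable_fun_norm_addHaar]
    simpa using hint
  rw [← ofReal_integral_eq_lintegral_ofReal h1 (ae_of_all _ fun y => hg _ (norm_nonneg y)),
    integral_fun_norm_addHaar]
  congr 1
  have h2 : volume.real (Metric.ball (0 : Plane) 1) = Real.pi := by
    rw [measureReal_def, EuclideanSpace.volume_ball_fin_two]
    simp [Real.pi_pos.le]
  rw [h2]
  simp [mul_assoc]

/-- With `u = s²` the integrand becomes a multiple of `1 / (u² + τ r⁴)`; this is where exponent four
makes the integral elementary. -/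
lemma hasDerivAt_arctan_sq {τ r : ℝ} (hτ : 0 < τ) (hr : 0 < r) (s : ℝ) :
    HasDerivAt (fun s => r ^ 2 * √τ / 2 * Real.arctan (s ^ 2 / (r ^ 2 * √τ)))
      (s * (τ * r ^ 4 / (s ^ 4 + τ * r ^ 4))) s := by
  obtain ⟨q, hqτ⟩ : ∃ q, √τ = q := ⟨_, rfl⟩
  have hq : 0 < q := hqτ ▸ Real.sqrt_pos.2 hτ
  have hq2 : τ = q ^ 2 := by rw [← hqτ, Real.sq_sqrt hτ.le]
  have h1 : HasDerivAt (fun s : ℝ => s ^ 2 / (r ^ 2 * q)) (2 * s / (r ^ 2 * q)) s := by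
    simpa using (hasDerivAt_pow 2 s).div_const (r ^ 2 * q)
  rw [hqτ, hq2]
  convert! (h1.arctan).const_mul (r ^ 2 * q / 2) using 1
  have : 0 < s ^ 4 + q ^ 2 * r ^ 4 := by positivity
  have : 0 < 1 + (s ^ 2 / (r ^ 2 * q)) ^ 2 := by positivity
  field_simp
  ring

lemma tendsto_arctan_sq {τ r : ℝ} (hτ : 0 < τ) (hr : 0 < r) :
    Tendsto (fun s => r ^ 2 * √τ / 2 * Real.arctan (s ^ 2 / (r ^ 2 * √τ))) atTop
      (𝓝 (r ^ 2 * √τ / 2 * (Real.pi / 2))) := by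
  have hq : 0 < √τ := Real.sqrt_pos.2 hτ
  refine Tendsto.const_mul _ ?_
  have h1 : Tendsto (fun s : ℝ => s ^ 2 / (r ^ 2 * √τ)) atTop atTop :=
    (tendsto_pow_atTop two_ne_zero).atTop_div_const (by positivity)
  exact (tendsto_nhds_of_tendsto_nhdsWithin Real.tendsto_arctan_atTop).comp h1

/-- The complement to one of the factor by which a station at distance `s` multiplies the
probability of coverage from distance `r`. -/
def radialLoss (p τ r s : ℝ) : ℝ :=
  1 - (if s < r then 1 - p else 1) * (1 / (1 + τ * r ^ 4 * (s ^ 4)⁻¹))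

lemma one_sub_expNeg_radialWeight {p τ : ℝ} (hp0 : 0 ≤ p) (hp1 : p ≤ 1) (hτ : 0 ≤ τ) (r : ℝ)
    (y : Plane) : 1 - expNeg (radialWeight p τ r y) = ENNReal.ofReal (radialLoss p τ r ‖y‖) := by
  have hpos : 0 ≤ τ * r ^ 4 * (‖y‖ ^ 4)⁻¹ := by positivity
  have h1 : (if ‖y‖ < r then ENNReal.ofReal (1 - p) else 1) =
      ENNReal.ofReal (if ‖y‖ < r then 1 - p else 1) := by split_ifs <;> simp
  have h2 : 0 ≤ if ‖y‖ < r then 1 - p else 1 := by split_ifs <;> linarith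
  rw [radialWeight, expNeg_add, h1, expNeg_negLog, expNeg_negLog, ← ENNReal.ofReal_mul h2,
    ← ENNReal.ofReal_one, ← ENNReal.ofReal_sub _ (by positivity), radialLoss]
  · rw [ENNReal.ofReal_le_one, div_le_one (by linarith)]
    linarith
  · rw [ENNReal.ofReal_le_one]
    split_ifs <;> linarith

lemma radialLoss_nonneg {p τ : ℝ} (hp0 : 0 ≤ p) (hτ : 0 ≤ τ) (r s : ℝ) :
    0 ≤ radialLoss p τ r s := by
  have hpos : 0 ≤ τ * r ^ 4 * (s ^ 4)⁻¹ := by positivity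
  have h1 : 1 / (1 + τ * r ^ 4 * (s ^ 4)⁻¹) ≤ 1 := by
    rw [div_le_one (by linarith)]
    linarith
  have h2 : 0 ≤ 1 / (1 + τ * r ^ 4 * (s ^ 4)⁻¹) := by positivity
  rw [radialLoss]
  split_ifs <;> nlinarith

lemma mul_radialLoss_of_lt {p τ r s : ℝ} (hτ : 0 < τ) (hr : 0 < r) (hs : 0 < s) (hsr : s < r) :
    s * radialLoss p τ r s = p * s + (1 - p) * (s * (τ * r ^ 4 / (s ^ 4 + τ * r ^ 4))) := by
  rw [radialLoss, if_pos hsr]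
  field_simp
  ring

lemma mul_radialLoss_of_le {p τ r s : ℝ} (hτ : 0 < τ) (hr : 0 < r) (hrs : r ≤ s) :
    s * radialLoss p τ r s = s * (τ * r ^ 4 / (s ^ 4 + τ * r ^ 4)) := by
  have hs : 0 < s := hr.trans_le hrs
  rw [radialLoss, if_neg (not_lt.2 hrs)]
  field_simp
  ring

/-- Split at `s = r`. Outside, only interference is lost; inside, a station is lost outright with
weight `p` and interferes with weight `1 - p`. The common primitive `Φ` handles both pieces. -/
lemma integral_mul_radialLoss {p τ r : ℝ} (hτ : 0 < τ) (hr : 0 < r) :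
    IntegrableOn (fun s => s * radialLoss p τ r s) (Ioi 0) ∧
      ∫ s in Ioi 0, s * radialLoss p τ r s = r ^ 2 / 2 *
        (p * (1 + √τ * Real.arctan √τ) + (1 - p) * (√τ * (Real.pi / 2))) := by
  have hq : 0 < √τ := Real.sqrt_pos.2 hτ
  set φ : ℝ → ℝ := fun s => s * (τ * r ^ 4 / (s ^ 4 + τ * r ^ 4)) with hφ
  set Φ : ℝ → ℝ := fun s => r ^ 2 * √τ / 2 * Real.arctan (s ^ 2 / (r ^ 2 * √τ)) with hΦ
  have hderiv : ∀ s, HasDerivAt Φ (φ s) s := hasDerivAt_arctan_sq hτ hr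
  have hφpos : ∀ s ∈ Ioi r, 0 ≤ φ s := fun s hs => by
    have : 0 < s := hr.trans hs
    simp only [hφ]; positivity
  have hφc : Continuous φ := by
    refine continuous_id.mul (continuous_const.div (by fun_prop) fun s => ?_)
    positivity
  have hi2 : IntegrableOn φ (Ioi r) :=
    integrableOn_Ioi_deriv_of_nonneg' (fun s _ => hderiv s) hφpos (tendsto_arctan_sq hτ hr)
  have hI2 : ∫ s in Ioi r, φ s = r ^ 2 * √τ / 2 * (Real.pi / 2) - Φ r :=
    integral_Ioi_of_hasDerivAt_of_nonneg' (fun s _ => hderiv s) hφpos (tendsto_arctan_sq hτ hr)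
  have hcont1 : Continuous fun s => p * s + (1 - p) * φ s := by fun_prop
  have hI1 : ∫ s in (0 : ℝ)..r, (p * s + (1 - p) * φ s) = p * (r ^ 2 / 2) + (1 - p) * Φ r := by
    have hd : ∀ s ∈ uIcc 0 r, HasDerivAt (fun s => p * (s ^ 2 / 2) + (1 - p) * Φ s)
        (p * s + (1 - p) * φ s) s := fun s _ => by
      have h2 : HasDerivAt (fun s : ℝ => s ^ 2 / 2) s s := by
        simpa using (hasDerivAt_pow 2 s).div_const 2
      exact (h2.const_mul p).add ((hderiv s).const_mul (1 - p))
    rw [intervalIntegral.integral_eq_sub_of_hasDerivAt hd (hcont1.intervalIntegrable _ _)]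
    simp [hΦ]
  have he1 : EqOn (fun s => s * radialLoss p τ r s) (fun s => p * s + (1 - p) * φ s) (Ioo 0 r) :=
    fun s hs => mul_radialLoss_of_lt hτ hr hs.1 hs.2
  have he2 : EqOn (fun s => s * radialLoss p τ r s) φ (Ici r) :=
    fun s hs => mul_radialLoss_of_le hτ hr hs
  have hi1' : IntegrableOn (fun s => s * radialLoss p τ r s) (Ioo 0 r) :=
    (integrableOn_congr_fun he1 measurableSet_Ioo).2
      ((hcont1.integrableOn_Icc (a := 0) (b := r)).mono_set Ioo_subset_Icc_self)
  have hi2' : IntegrableOn (fun s => s * radialLoss p τ r s) (Ici r) :=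
    (integrableOn_congr_fun he2 measurableSet_Ici).2 ((integrableOn_Ici_iff_integrableOn_Ioi (by simp)).2 hi2)
  have hU : Ioi (0 : ℝ) = Ioo 0 r ∪ Ici r := (Ioo_union_Ici_eq_Ioi hr).symm
  have hdisj : Disjoint (Ioo 0 r) (Ici r) :=
    disjoint_left.2 fun s h1 h2 => absurd h1.2 (not_lt.2 h2)
  refine ⟨hU ▸ hi1'.union hi2', ?_⟩
  rw [hU, setIntegral_union hdisj measurableSet_Ici hi1' hi2',
    setIntegral_congr_fun measurableSet_Ioo he1, setIntegral_congr_fun measurableSet_Ici he2,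
    integral_Ici_eq_integral_Ioi, hI2, ← integral_Ioc_eq_integral_Ioo,
    ← intervalIntegral.integral_of_le hr.le, hI1]
  -- Here `Φ r` contains `arctan (1 / √τ)`, rewritten by the reflection `arctan (1 / x) = π / 2 -
  -- arctan x`.
  have h3 : Φ r = r ^ 2 * √τ / 2 * (Real.pi / 2 - Real.arctan √τ) := by
    rw [← Real.arctan_inv_of_pos hq]
    simp only [hΦ]
    congr 2
    field_simp
  rw [h3]
  ring

lemma lintegral_one_sub_expNeg_radialWeight {p τ r : ℝ} (hp0 : 0 ≤ p) (hp1 : p ≤ 1) (hτ : 0 < τ)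
    (hr : 0 < r) :
    ∫⁻ y, (1 - expNeg (radialWeight p τ r y)) = ENNReal.ofReal (Real.pi * r ^ 2 *
      (p * (1 + √τ * Real.arctan √τ) + (1 - p) * (√τ * (Real.pi / 2)))) := by
  obtain ⟨h1, h2⟩ := integral_mul_radialLoss (p := p) hτ hr
  simp_rw [one_sub_expNeg_radialWeight hp0 hp1 hτ.le]
  rw [lintegral_ofReal_norm (fun s _ => radialLoss_nonneg hp0 hτ.le r s) h1, h2]
  ring_nf

/-- `∫ s exp (-(B s⁴ + C s²)) ds` over the positive reals. -/
lemma integral_mul_exp_quartic {B C : ℝ} (hB : 0 < B) (hC : 0 ≤ C) :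
    IntegrableOn (fun s : ℝ => s * Real.exp (-(B * s ^ 4 + C * s ^ 2))) (Ioi 0) ∧
    ∫ s in Ioi 0, s * Real.exp (-(B * s ^ 4 + C * s ^ 2)) =
      1 / 4 * √(Real.pi / B) * Real.exp (C ^ 2 / (4 * B)) * erfc (C / (2 * √B)) := by
  have hq : 0 < √B := Real.sqrt_pos.2 hB
  have hq2 : √B ^ 2 = B := Real.sq_sqrt hB.le
  -- Completing the square in `s²`: `B s⁴ + C s² = f(s)² - C² / (4 B)`, so `t = f(s)` is the
  -- substitution.
  set f : ℝ → ℝ := fun s => √B * s ^ 2 + C / (2 * √B) with hf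
  set f' : ℝ → ℝ := fun s => 2 * √B * s with hf'
  set g : ℝ → ℝ := fun t => Real.exp (-t ^ 2) with hg
  have hgi : Integrable g := by
    simpa using integrable_exp_neg_mul_sq (b := 1) one_pos
  have hfd : ∀ s, HasDerivAt f (f' s) s := fun s => by
    have := ((hasDerivAt_pow 2 s).const_mul (√B)).add_const (C / (2 * √B))
    convert! this using 1
    simp only [hf']
    push_cast
    ring
  have hkey : ∀ s, s * Real.exp (-(B * s ^ 4 + C * s ^ 2)) =
      Real.exp (C ^ 2 / (4 * B)) / (2 * √B) * ((g ∘ f) s * f' s) := by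
    intro s
    have h1 : Real.exp (-(B * s ^ 4 + C * s ^ 2)) =
        Real.exp (C ^ 2 / (4 * B)) * Real.exp (-(f s) ^ 2) := by
      rw [← Real.exp_add]
      congr 1
      have h2 : f s ^ 2 = √B ^ 2 * s ^ 4 + C * s ^ 2 + C ^ 2 / (4 * √B ^ 2) := by
        simp only [hf]
        field_simp
        ring
      rw [h2, hq2]
      ring
    rw [h1]
    simp only [hg, hf', Function.comp_apply]
    field_simp
  have hint : Integrable fun s : ℝ => s * Real.exp (-(B * s ^ 4 + C * s ^ 2)) := by
    -- The majorant comes from `B s⁴ ≥ s² - 1 / (4 B)`, a square being nonnegative; it needs no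
    -- decay from `C`, which may be `0`.
    have h1 := (integrable_mul_exp_neg_mul_sq one_pos).const_mul (Real.exp (1 / (4 * B)))
    refine h1.mono (by fun_prop) (ae_of_all _ fun s => ?_)
    rw [norm_mul, norm_mul, norm_mul, Real.norm_eq_abs (Real.exp _), Real.norm_eq_abs (Real.exp _),
      Real.norm_eq_abs (Real.exp _), Real.abs_exp, Real.abs_exp, Real.abs_exp, mul_left_comm,
      ← Real.exp_add]
    gcongr
    have h2 : 0 ≤ (√B * s ^ 2 - 1 / (2 * √B)) ^ 2 := sq_nonneg _
    have h3 : (√B * s ^ 2 - 1 / (2 * √B)) ^ 2 = √B ^ 2 * s ^ 4 - s ^ 2 + 1 / (4 * √B ^ 2) := by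
      field_simp
      ring
    rw [h3, hq2] at h2
    have h4 : 0 ≤ C * s ^ 2 := by positivity
    linarith
  have hcomp : IntegrableOn (fun s => (g ∘ f) s * f' s) (Ici 0) := by
    have h1 := (hint.const_mul ((Real.exp (C ^ 2 / (4 * B)) / (2 * √B))⁻¹)).integrableOn
      (s := Ici 0)
    refine h1.congr_fun (fun s _ => ?_) measurableSet_Ici
    simp only [hkey]
    have : Real.exp (C ^ 2 / (4 * B)) / (2 * √B) ≠ 0 := by positivity
    field_simp
  have hsub := integral_comp_mul_deriv_Ioi (f := f) (f' := f') (g := g) (a := 0)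
    (by fun_prop) ?_ (fun s _ => (hfd s).hasDerivWithinAt) (by fun_prop) hgi.integrableOn hcomp
  · refine ⟨hint.integrableOn, ?_⟩
    simp_rw [hkey]
    rw [integral_const_mul, hsub, erfc]
    have h0 : f 0 = C / (2 * √B) := by simp [hf]
    rw [h0, Real.sqrt_div Real.pi_pos.le]
    have : 0 < √Real.pi := Real.sqrt_pos.2 Real.pi_pos
    simp only [hg]
    field_simp
    ring
  · exact tendsto_atTop_add_const_right _ _
      ((tendsto_pow_atTop two_ne_zero).const_mul_atTop hq)

/-! ### The special functions at path loss exponent four -/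

/-- The Pochhammer symbols at `-1/2` and `1/2` differ by a unit shift, so their ratio telescopes to
`1 / (1 - 2 n)`. -/
lemma ordinaryHypergeometric_coeff (n : ℕ) :
    ((n.factorial : ℝ)⁻¹ * (ascPochhammer ℝ n).eval (-1 / 2) * (ascPochhammer ℝ n).eval 1 *
      ((ascPochhammer ℝ n).eval (1 / 2))⁻¹) = 1 / (1 - 2 * n) := by
  have h1 : (ascPochhammer ℝ n).eval 1 = n.factorial := by
    simp
  have hpos : (ascPochhammer ℝ n).eval (1 / 2) ≠ 0 := (ascPochhammer_pos n _ (by norm_num)).ne'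
  have h2 : (ascPochhammer ℝ n).eval (-1 / 2) * (1 - 2 * n) =
      (ascPochhammer ℝ n).eval (1 / 2) := by
    clear h1 hpos
    induction n with
    | zero => simp
    | succ n ih =>
      rw [ascPochhammer_succ_eval, ascPochhammer_succ_eval, ← ih]
      push_cast
      ring
  have h3 : (1 - 2 * n : ℝ) ≠ 0 := by
    intro h
    rw [h, mul_zero] at h2
    exact hpos h2.symm
  have h4 : (n.factorial : ℝ) ≠ 0 := by positivity
  have h5 : (ascPochhammer ℝ n).eval (-1 / 2) ≠ 0 := by
    intro h
    rw [h, zero_mul] at h2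
    exact hpos h2.symm
  rw [h1, ← h2]
  generalize (ascPochhammer ℝ n).eval (-1 / 2) = e at h5
  field_simp

lemma ordinaryHypergeometric_eq_arctan {y : ℝ} (hy : -1 < y) (hy0 : y < 0) :
    ordinaryHypergeometric (-1 / 2 : ℝ) (1 : ℝ) (1 / 2 : ℝ) y =
      1 + √(-y) * Real.arctan √(-y) := by
  have hq : √(-y) < 1 := by rw [Real.sqrt_lt' one_pos]; linarith
  have hq0 : 0 ≤ √(-y) := Real.sqrt_nonneg _
  have hq2 : √(-y) ^ 2 = -y := Real.sq_sqrt (by linarith)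
  have h1 := (Real.hasSum_arctan (x := √(-y)) (by rwa [Real.norm_eq_abs, abs_of_nonneg hq0])).mul_left
    (√(-y))
  rw [ordinaryHypergeometric_eq_tsum]
  simp only [ordinaryHypergeometric_coeff, smul_eq_mul]
  refine HasSum.tsum_eq ?_
  -- The constant term is the summand `1`; the rest is `√(-y)` times the arctangent series at
  -- `√(-y)`.
  rw [← hasSum_nat_add_iff' 1]
  simp only [Finset.range_one, Finset.sum_singleton, Nat.cast_zero, mul_zero, sub_zero, pow_zero,
    add_sub_cancel_left, div_one, mul_one]
  refine h1.congr_fun fun n => ?_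
  have h2 : y = -√(-y) ^ 2 := by rw [hq2]; ring
  have h3 : (1 - 2 * ((n + 1 : ℕ) : ℝ)) = -(2 * n + 1) := by push_cast; ring
  rw [h3]
  conv_lhs => rw [h2]
  rw [neg_pow, pow_succ (-1 : ℝ), ← pow_mul]
  push_cast
  field_simp
  ring

/-- The series is analytic on `(-1, 1)` and the arctangent expression on `(-∞, 0)`; they agree on
`(-1, 0)`, so the glued function is analytic on `(-∞, 1)`. -/
lemma isGaussContinuation_half :
    IsGaussContinuation (-1 / 2) 1 (1 / 2) (fun y => if -1 < y then
      ordinaryHypergeometric (-1 / 2 : ℝ) (1 : ℝ) (1 / 2 : ℝ) y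
      else 1 + √(-y) * Real.arctan √(-y)) := by
  constructor
  · intro y hy
    rcases lt_or_ge y 0 with hy0 | hy0
    · have h1 : AnalyticAt ℝ (fun y : ℝ => 1 + √(-y) * Real.arctan √(-y)) y := by
        -- The order `⊤` of `WithTop ℕ∞` means analytic, not merely smooth.
        have h2 : ContDiffAt ℝ (⊤ : WithTop ℕ∞) (fun y : ℝ => 1 + √(-y) * Real.arctan √(-y)) y := by
          have h3 : ContDiffAt ℝ (⊤ : WithTop ℕ∞) (fun y : ℝ => √(-y)) y :=
            contDiffAt_id.neg.sqrt (by simpa using hy0.ne)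
          exact contDiffAt_const.add (h3.mul (Real.contDiff_arctan.contDiffAt.comp y h3))
        exact h2.analyticAt
      refine h1.congr ?_
      filter_upwards [Iio_mem_nhds hy0] with z hz
      split_ifs with hz1
      · exact (ordinaryHypergeometric_eq_arctan hz1 hz).symm
      · rfl
    · have hrad : (ordinaryHypergeometricSeries ℝ (-1 / 2 : ℝ) 1 (1 / 2)).radius = 1 := by
        refine ordinaryHypergeometricSeries_radius_eq_one _ _ _ _ fun k => ⟨?_, ?_, ?_⟩
        · intro h
          have h2 : ((2 * k : ℕ) : ℝ) = (1 : ℕ) := by push_cast; linarith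
          have := Nat.cast_injective h2
          omega
        · have : (0 : ℝ) ≤ k := k.cast_nonneg
          intro h; linarith
        · have : (0 : ℝ) ≤ k := k.cast_nonneg
          intro h; linarith
      have h1 : AnalyticAt ℝ (ordinaryHypergeometric (-1 / 2 : ℝ) (1 : ℝ) (1 / 2 : ℝ)) y := by
        have h2 := (ordinaryHypergeometricSeries ℝ (-1 / 2 : ℝ) 1 (1 / 2)).hasFPowerSeriesOnBall
          (by rw [hrad]; exact one_pos)
        refine h2.analyticAt_of_mem ?_
        rw [hrad, Metric.mem_eball, edist_zero_right]
        rw [← ofReal_norm, ENNReal.ofReal_lt_one, Real.norm_eq_abs, abs_of_nonneg hy0]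
        exact hy
      refine h1.congr ?_
      filter_upwards [Ioi_mem_nhds (show -1 < y by linarith)] with z hz
      rw [if_pos (mem_Ioi.1 hz)]
  · intro y hy
    exact if_pos (abs_lt.1 hy).1

lemma S_zero_four_one {τ : ℝ} (hτ : 0 < τ) : S 0 4 1 τ = 1 + √τ * Real.arctan √τ := by
  have h1 : S 0 4 1 τ = gauss2F1 (-1 / 2) 1 (1 / 2) (-τ) := by
    rw [S]
    norm_num
  rw [h1, gauss2F1_eq isGaussContinuation_half (x := -τ) (by linarith)]
  split_ifs with h
  · rw [ordinaryHypergeometric_eq_arctan h (by linarith), neg_neg]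
  · rw [neg_neg]

lemma Δ_four_one (τ : ℝ) : Δ 4 1 τ = √τ * (Real.pi / 2) := by
  have h1 : Real.Gamma (1 - 2 / 4) = √Real.pi := by
    rw [← Real.Gamma_one_half_eq]
    norm_num
  have h2 : Real.Gamma (((1 : ℕ) : ℝ) + 2 / 4) = 1 / 2 * √Real.pi := by
    rw [← Real.Gamma_one_half_eq, ← Real.Gamma_add_one (by norm_num)]
    norm_num
  have h3 : τ ^ ((2 : ℝ) / 4) = √τ := by
    rw [Real.sqrt_eq_rpow]
    norm_num
  rw [Δ, h1, h2, h3]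
  have : √Real.pi * √Real.pi = Real.pi := Real.mul_self_sqrt Real.pi_pos.le
  simp only [Nat.cast_one, Real.Gamma_one, inv_one, mul_one]
  linear_combination (1 / 2 * √τ) * this

/-! ### Assembly of the closed form -/

lemma IsMacroTier.coverageProbability_eq {Ω : Type*} [MeasurableSpace Ω] {μ : Measure Ω}
    [IsProbabilityMeasure μ] {lam p P C σ τ : ℝ} {N : ℕ} {X : ℕ → Ω → Plane} {h : ℕ → Ω → ℂ}
    {cached : ℕ → Ω → Bool} (hmodel : IsMacroTier μ lam p X h cached) (hlam : 0 < lam)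
    (hp0 : 0 ≤ p) (hp1 : p ≤ 1) (hP : 0 < P) (hC : 0 < C) (hN : 0 < N) (hσ : σ ≠ 0) (hτ : 0 < τ) :
    coverageProbability μ P C 4 σ N X h cached τ =
      1 / 2 * Real.pi * p * lam * √(Real.pi / coeffB P C σ N τ) *
        Real.exp (coeffC lam p 4 τ ^ 2 / (4 * coeffB P C σ N τ)) *
        erfc (coeffC lam p 4 τ / (2 * √(coeffB P C σ N τ))) := by
  have hN' : (0 : ℝ) < N := by exact_mod_cast hN
  have hB : 0 < coeffB P C σ N τ := by
    have : 0 < σ ^ 2 := by positivity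
    rw [coeffB, G₀]
    positivity
  set B := coeffB P C σ N τ with hB_def
  set D := coeffC lam p 4 τ with hD_def
  have hD_eq : D = Real.pi * lam *
      (p * (1 + √τ * Real.arctan √τ) + (1 - p) * (√τ * (Real.pi / 2))) := by
    rw [hD_def, coeffC, S_zero_four_one hτ, Δ_four_one]
  have hD : 0 ≤ D := by
    have h1 : 0 ≤ Real.arctan √τ := Real.arctan_nonneg.2 (Real.sqrt_nonneg _)
    have h2 : 0 ≤ 1 - p := by linarith
    rw [hD_eq]
    positivity
  obtain ⟨hint, hval⟩ := integral_mul_exp_quartic hB hD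
  have hpt : ∀ᵐ x : Plane, expNeg (ENNReal.ofReal (B * ‖x‖ ^ 4) +
      ENNReal.ofReal lam * ∫⁻ y, (1 - expNeg (radialWeight p τ ‖x‖ y))) =
      ENNReal.ofReal (Real.exp (-(B * ‖x‖ ^ 4 + D * ‖x‖ ^ 2))) := by
    have hne : ∀ᵐ x : Plane, x ≠ 0 := by simp [ae_iff]
    filter_upwards [hne] with x hx
    rw [lintegral_one_sub_expNeg_radialWeight hp0 hp1 hτ (norm_pos_iff.2 hx),
      ← ENNReal.ofReal_mul hlam.le]
    have h1 : lam * (Real.pi * ‖x‖ ^ 2 *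
        (p * (1 + √τ * Real.arctan √τ) + (1 - p) * (√τ * (Real.pi / 2)))) = D * ‖x‖ ^ 2 := by
      rw [hD_eq]; ring
    rw [h1, ← ENNReal.ofReal_add (by positivity) (by positivity), expNeg_ofReal (by positivity)]
  have hI : 0 ≤ ∫ s in Ioi 0, s * Real.exp (-(B * s ^ 4 + D * s ^ 2)) :=
    setIntegral_nonneg measurableSet_Ioi fun s hs =>
      mul_nonneg (le_of_lt hs) (Real.exp_pos _).le
  rw [coverageProbability, measureReal_def, hmodel.measure_lt_sinr hlam.le hp0 hP hC hN hσ hτ,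
    lintegral_congr_ae hpt,
    lintegral_ofReal_norm (g := fun s => Real.exp (-(B * s ^ 4 + D * s ^ 2)))
      (fun s _ => (Real.exp_pos _).le) hint,
    ← ENNReal.ofReal_mul hlam.le, ← ENNReal.ofReal_mul hp0, ENNReal.toReal_ofReal (by positivity),
    hval]
  ring

end

end CacheHetNet

theorem corollary3 {Ω : Type*} [MeasurableSpace Ω] (μ : Measure Ω) [IsProbabilityMeasure μ]
    (lam p P C σ τ : ℝ) (N : ℕ)
    (hlam : 0 < lam) (hp0 : 0 ≤ p) (hp1 : p ≤ 1) (hP : 0 < P) (hC : 0 < C) (hN : 0 < N)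
    (hσ : σ ≠ 0) (hτ : 0 < τ)
    (X : ℕ → Ω → CacheHetNet.Plane) (h : ℕ → Ω → ℂ) (cached : ℕ → Ω → Bool)
    (hmodel : CacheHetNet.IsMacroTier μ lam p X h cached) :
    CacheHetNet.coverageProbability μ P C 4 σ N X h cached τ =
      1 / 2 * Real.pi * p * lam * √(Real.pi / CacheHetNet.coeffB P C σ N τ) *
        Real.exp (CacheHetNet.coeffC lam p 4 τ ^ 2 / (4 * CacheHetNet.coeffB P C σ N τ)) *
        CacheHetNet.erfc
          (CacheHetNet.coeffC lam p 4 τ / (2 * √(CacheHetNet.coeffB P C σ N τ))) := by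
  exact hmodel.coverageProbability_eq hlam hp0 hp1 hP hC hN hσ hτ
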